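/- **Setting.** A *channel* $c:X\to M\times Y$ is a Markov kernel between measurable spaces; it is called a channel from $X$ to $Y$ coparameterized by $M$. For a probability measure $\pi$ on $X$, $c\bullet\pi$ denotes the resulting predictive law on $Y$ (the coparameter being discarded). The *copy-composite* of $c:X\to M\times Y$ and $d:Y\to N\times Z$ is the channel $X\to((M\times Y)\times N)\times Z$ that samples $(m,y)\sim c(x)$, $(n,z)\sim d(y)$ and returns $((m,y),n),z$. A 2-cell from $c:X\to M\times Y$ to $c':X\to M'\times Y$ is a Markov kernel $\varphi: X\times M\times Y\to M'$ such that sampling $(m,y)\sim c(x)$, $m'\sim\varphi(x,m,y)$ and keeping $(m',y)$ gives $c'(x)$; two such $\varphi$ are identified when they agree $c(x)$-almost surely for every $x$. A *simple lens* $(c,c'):X\to Y$ is a channel $c:X\to M\times Y$ with, for each probability measure $\pi$ on $X$, a channel $c'_\pi:Y\to M\times X$ with the same coparameter. The composite of $(c,c'):X\to Y$ and $(d,d'):Y\to Z$ has as forward part the copy-composite of $c$ and $d$, and as backward part at $\pi$ the copy-composite of $d'_{c\bullet\pi}$ followed by $c'_\pi$ (with the coparameters listed as in the forward part). A 2-cell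 of lenses is a forward 2-cell with a backward 2-cell for every $\pi$. Simple lenses form a bicategory. Let $\mathcal B$ be a sub-bicategory of it with only structural 2-cells: a class of 0-cells and a class of 1-cells closed under identities and composition, the 2-cells being those generated by identities, associators, unitors and their inverses (of 1-cells of $\mathcal B$) under vertical composition and whiskering. **Losses and games.** A *loss* $L:Y\xrightarrow{X}I$ assigns to each probability measure $\pi$ on $X$ a measurable function $L_\pi:Y\to[0,\infty]$. Fix one of two notions of equality of losses for a lens $(c,c'):X\to Y$: (P) *pointwise*, $L_\pi(y)=L'_\pi(y)$ for all $\pi,y$; (A) *almost sure*, for all $\pi$ and $c\bullet\pi$-almost all $y$. In case (A) assume that the backward channels are nonsingular: for every lens of $\mathcal B$, every $\pi$ and every $\pi$-conull $S$, $c'_\pi(y)$ gives $S$ (in the $X$-coordinate) probability one for $c\bullet\pi$-almost all $y$ (for instance $c'_\pi(y)\ll c^\dagger_\pi(y)$ almost surely suffices). The *bicategory of statistical games* over $\mathcal B$ has the 0-cells of $\mathcal B$; 1-cells are pairs of a lens $c$ of $\mathcal B$ and a loss $L^c$ (up to the chosen equality); 2-cells $(c,L^{c})\Rightarrow(d,L^{d})$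 are pairs of a 2-cell $c\Rightarrow d$ of $\mathcal B$ and a loss $K$ with $L^{c}=L^{d}+K$. Identities carry the loss $0$, vertical composition adds losses $K$, and the composite of $(c,L^c)$ and $(d,L^d)$ carries the loss $$\pi,z\;\longmapsto\; L^d_{c\bullet\pi}(z)+\int L^c_\pi(y)\; d'_{c\bullet\pi}(z)(dy),$$ the coparameter of $d'$ being discarded; losses $K$ of 2-cells compose horizontally by the same formula. Forgetting losses is a strict 2-functor $\pi_{\mathrm{Loss}}$ to $\mathcal B$. **Bayesian inversion.** A channel $\rho:Y\to M\times X$ is a Bayesian inversion of $c$ at $\pi$ if sampling $x\sim\pi$, $(m,y)\sim c(x)$ and sampling $y\sim c\bullet\pi$, $(m,x)\sim\rho(y)$ give the same law of $(x,m,y)$. **Proposition.** Suppose a Bayesian inversion $c^\dagger_\pi$ has been chosen for the forward channel $c$ of every lens of $\mathcal B$ and every $\pi$; in case (P) suppose moreover that the choice is strictly compatible with identities and copy-composition, i.e. $\mathrm{id}^\dagger_\pi=\mathrm{id}$ and the inversion of the copy-composite of $c$ and $d$ at $\pi$ is the copy-composite of $d^\dagger_{c\bullet\pi}$ followed by $c^\dagger_\pi$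 (in case (A) the choice is arbitrary). Suppose that for every lens $(c,c')$ of $\mathcal B$ and every $\pi$ the channels $c'_\pi$ and $c^\dagger_\pi$ have jointly measurable densities with respect to a common measure, possibly depending on $y$: there are measures $\nu_y$ on $M\times X$ and measurable $p,q:Y\times(M\times X)\to[0,\infty]$ with $c'_\pi(y)=p(y,\cdot)\,\nu_y$ and $c^\dagger_\pi(y)=q(y,\cdot)\,\nu_y$ for all $y$ in case (P), for $c\bullet\pi$-almost all $y$ in case (A). Then the relative entropy $$\mathsf{KL}(c,c')_\pi(y)=D_{KL}\bigl(c'_\pi(y),\,c^\dagger_\pi(y)\bigr)\in[0,\infty]$$ (equal to $\infty$ if $c'_\pi(y)\not\ll c^\dagger_\pi(y)$) defines a loss, for all $y$ in case (P) and for $c\bullet\pi$-almost all $y$ in case (A), and $(c,c')\mapsto((c,c'),\mathsf{KL}(c,c'))$ is the action on 0- and 1-cells of a strict loss model: a strict 2-functor from $\mathcal B$ to statistical games over $\mathcal B$ which is a section of $\pi_{\mathrm{Loss}}$. -/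

import Mathlib

open CategoryTheory MeasureTheory ProbabilityTheory
open scoped ENNReal

universe u

namespace StatGames

/-! ### Markov kernels with a coparameter, and their 2-cells -/

@[fun_prop]
theorem measurable_lintegral_kernel_comp {U S T : Type*} [MeasurableSpace U] [MeasurableSpace S]
    [MeasurableSpace T] (η : Kernel S T) [IsSFiniteKernel η] {g : U → S} {F : U → T → ℝ≥0∞}
    (hg : Measurable g) (hF : Measurable (fun p : U × T => F p.1 p.2)) :
    Measurable (fun u => ∫⁻ t, F u t ∂(η (g u))) :=
  Measurable.lintegral_kernel_prod_right' (κ := η.comap g hg) hF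

section Cells

variable {A B C D M N P Q : Type u} [MeasurableSpace A] [MeasurableSpace B] [MeasurableSpace C]
  [MeasurableSpace D] [MeasurableSpace M] [MeasurableSpace N] [MeasurableSpace P]
  [MeasurableSpace Q]

/-- Run `φ` on the input, the coparameter and the output of `κ`, and replace the coparameter. -/
noncomputable def push (κ : Kernel A (M × B)) (φ : Kernel (A × M × B) N) : Kernel A (N × B) :=
  (κ ⊗ₖ φ).map (fun t => (t.2, t.1.2))

theorem lintegral_push (κ : Kernel A (M × B)) [IsMarkovKernel κ] (φ : Kernel (A × M × B) N)
    [IsMarkovKernel φ] (a : A) {F : N × B → ℝ≥0∞} (hF : Measurable F) :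
    ∫⁻ t, F t ∂(push κ φ a) = ∫⁻ w, ∫⁻ n, F (n, w.2) ∂(φ (a, w)) ∂(κ a) := by
  rw [push, Kernel.map_apply _ (by fun_prop), lintegral_map hF (by fun_prop),
    Kernel.lintegral_compProd _ _ _ (by fun_prop)]

/-- A representative of a 2-cell between kernels with the same domain and codomain `A`, `B` and with
coparameters `M` and `N`: a Markov kernel satisfying the change-of-coparameter axiom. -/
structure PreCell (κ : Kernel A (M × B)) (κ' : Kernel A (N × B)) where
  ker : Kernel (A × M × B) N
  markov : IsMarkovKernel ker
  eq : push κ ker = κ'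

attribute [instance] PreCell.markov

/-- Almost sure equality of 2-cells, relative to the source. -/
instance PreCell.setoid (κ : Kernel A (M × B)) (κ' : Kernel A (N × B)) :
    Setoid (PreCell κ κ') where
  r φ ψ := κ ⊗ₖ φ.ker = κ ⊗ₖ ψ.ker
  iseqv := ⟨fun _ => rfl, fun h => h.symm, fun h h' => h.trans h'⟩

/-- 2-cells: representatives up to almost sure equality. -/
def Cell (κ : Kernel A (M × B)) (κ' : Kernel A (N × B)) : Type u :=
  Quotient (PreCell.setoid κ κ')

theorem kernel_ext_lintegral {S T : Type*} [MeasurableSpace S] [MeasurableSpace T]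
    {κ η : Kernel S T}
    (h : ∀ s, ∀ F : T → ℝ≥0∞, Measurable F → ∫⁻ t, F t ∂(κ s) = ∫⁻ t, F t ∂(η s)) : κ = η := by
  ext s U hU
  have := h s (U.indicator 1) (measurable_one.indicator hU)
  simpa [hU] using this

theorem PreCell.rel_iff {κ : Kernel A (M × B)} [IsMarkovKernel κ] {κ' : Kernel A (N × B)}
    {φ ψ : PreCell κ κ'} :
    κ ⊗ₖ φ.ker = κ ⊗ₖ ψ.ker ↔ ∀ a, ∀ F : (M × B) × N → ℝ≥0∞, Measurable F →
      ∫⁻ w, ∫⁻ n, F (w, n) ∂(φ.ker (a, w)) ∂(κ a) = ∫⁻ w, ∫⁻ n, F (w, n) ∂(ψ.ker (a, w)) ∂(κ a) := by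
  constructor
  · intro h a F hF
    rw [← Kernel.lintegral_compProd _ _ _ hF, ← Kernel.lintegral_compProd _ _ _ hF, h]
  · intro h
    refine kernel_ext_lintegral fun a F hF => ?_
    rw [Kernel.lintegral_compProd _ _ _ hF, Kernel.lintegral_compProd _ _ _ hF, h a F hF]

/-- Vertical composition at the level of kernels. -/
noncomputable def vcomp (φ : Kernel (A × M × B) N) (ψ : Kernel (A × N × B) P) :
    Kernel (A × M × B) P :=
  (φ ⊗ₖ ψ.comap (fun q : (A × M × B) × N => (q.1.1, q.2, q.1.2.2)) (by fun_prop)).snd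

instance (φ : Kernel (A × M × B) N) [IsMarkovKernel φ] (ψ : Kernel (A × N × B) P)
    [IsMarkovKernel ψ] : IsMarkovKernel (vcomp φ ψ) := by
  unfold vcomp; infer_instance

theorem lintegral_vcomp (φ : Kernel (A × M × B) N) [IsMarkovKernel φ] (ψ : Kernel (A × N × B) P)
    [IsMarkovKernel ψ] (a : A) (w : M × B) {F : P → ℝ≥0∞} (hF : Measurable F) :
    ∫⁻ t, F t ∂(vcomp φ ψ (a, w)) = ∫⁻ n, ∫⁻ p, F p ∂(ψ (a, n, w.2)) ∂(φ (a, w)) := by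
  rw [vcomp, Kernel.lintegral_snd _ _ hF, Kernel.lintegral_compProd _ _ _ (by fun_prop)]
  rfl

/-- Run `φ` on the data selected by `v` and rebuild the result with `r`. -/
noncomputable def lift {T : Type u} [MeasurableSpace T] (φ : Kernel (A × M × B) N)
    (v : T → A × M × B) (hv : Measurable v) (r : T × N → P) : Kernel T P :=
  (Kernel.id ×ₖ φ.comap v hv).map r

theorem lift_isMarkov {T : Type u} [MeasurableSpace T] (φ : Kernel (A × M × B) N)
    [IsMarkovKernel φ] (v : T → A × M × B) (hv : Measurable v) (r : T × N → P)
    (hr : Measurable r) : IsMarkovKernel (lift φ v hv r) :=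
  Kernel.IsMarkovKernel.map _ hr

theorem lintegral_lift {T : Type u} [MeasurableSpace T] (φ : Kernel (A × M × B) N)
    [IsMarkovKernel φ] (v : T → A × M × B) (hv : Measurable v) (r : T × N → P)
    (hr : Measurable r) (t : T) {F : P → ℝ≥0∞} (hF : Measurable F) :
    ∫⁻ p, F p ∂(lift φ v hv r t) = ∫⁻ n, F (r (t, n)) ∂(φ (v t)) := by
  rw [lift, Kernel.map_apply _ hr, lintegral_map hF hr, Kernel.prod_apply, Kernel.id_apply,
    Kernel.comap_apply, Measure.dirac_prod, lintegral_map (by fun_prop) (by fun_prop)]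


theorem PreCell.lintegral_tgt {κ : Kernel A (M × B)} [IsMarkovKernel κ] {κ' : Kernel A (N × B)}
    (φ : PreCell κ κ') (a : A) {F : N × B → ℝ≥0∞} (hF : Measurable F) :
    ∫⁻ t, F t ∂(κ' a) = ∫⁻ w, ∫⁻ n, F (n, w.2) ∂(φ.ker (a, w)) ∂(κ a) := by
  have := lintegral_push κ φ.ker a hF
  rwa [φ.eq] at this

theorem lintegral_det {S T : Type u} [MeasurableSpace S] [MeasurableSpace T] (r : S → T)
    (hr : Measurable r) (s : S) {F : T → ℝ≥0∞} (hF : Measurable F) :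
    ∫⁻ t, F t ∂(Kernel.deterministic r hr s) = F (r s) := by
  rw [Kernel.deterministic_apply, lintegral_dirac' _ hF]

/-- The deterministic 2-cell given by a function `r`. -/
noncomputable def PreCell.det (κ : Kernel A (M × B)) [IsMarkovKernel κ] (κ' : Kernel A (N × B))
    (r : A × M × B → N) (hr : Measurable r)
    (h : ∀ a, ∀ F : N × B → ℝ≥0∞, Measurable F →
      ∫⁻ t, F t ∂(κ' a) = ∫⁻ w, F (r (a, w), w.2) ∂(κ a)) : PreCell κ κ' where
  ker := Kernel.deterministic r hr
  markov := inferInstance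
  eq := by
    refine kernel_ext_lintegral fun a F hF => ?_
    rw [lintegral_push _ _ _ hF, h a F hF]
    exact lintegral_congr fun w => lintegral_det r hr _ (by fun_prop)

/-- The identity 2-cell discards the input and the output. -/
noncomputable def PreCell.id (κ : Kernel A (M × B)) [IsMarkovKernel κ] : PreCell κ κ :=
  PreCell.det κ κ (fun p => p.2.1) (by fun_prop) (fun _ _ _ => rfl)

/-- Vertical composition of 2-cells. -/
noncomputable def PreCell.comp {κ : Kernel A (M × B)} [IsMarkovKernel κ] {κ' : Kernel A (N × B)}
    [IsMarkovKernel κ'] {κ'' : Kernel A (P × B)} (φ : PreCell κ κ') (ψ : PreCell κ' κ'') :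
    PreCell κ κ'' where
  ker := vcomp φ.ker ψ.ker
  markov := inferInstance
  eq := by
    refine kernel_ext_lintegral fun a F hF => ?_
    rw [ψ.lintegral_tgt _ hF, lintegral_push _ _ _ hF, φ.lintegral_tgt _ (by fun_prop)]
    refine lintegral_congr fun w => ?_
    rw [lintegral_vcomp _ _ _ _ (by fun_prop)]

theorem PreCell.comp_congr {κ : Kernel A (M × B)} [IsMarkovKernel κ] {κ' : Kernel A (N × B)}
    [IsMarkovKernel κ'] {κ'' : Kernel A (P × B)} {φ φ' : PreCell κ κ'} {ψ ψ' : PreCell κ' κ''}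
    (h : φ ≈ φ') (h' : ψ ≈ ψ') : φ.comp ψ ≈ φ'.comp ψ' := by
  have h1 : φ.comp ψ ≈ φ'.comp ψ := by
    refine PreCell.rel_iff.2 fun a F hF => ?_
    have := PreCell.rel_iff.1 h a (fun q => ∫⁻ p, F (q.1, p) ∂(ψ.ker (a, q.2, q.1.2)))
      (by fun_prop)
    simp only [PreCell.comp]
    convert this using 3 with w w <;> exact lintegral_vcomp _ _ _ _ (by fun_prop)
  refine h1.trans ?_
  have key : ∀ (S : Set P), MeasurableSet S → ∀ a, ∀ᵐ t ∂(κ' a),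
      ψ.ker (a, t) S = ψ'.ker (a, t) S := by
    intro S hS a
    refine ae_eq_of_forall_setLIntegral_eq_of_sigmaFinite
      ((Kernel.measurable_coe _ hS).comp measurable_prodMk_left)
      ((Kernel.measurable_coe _ hS).comp measurable_prodMk_left) fun U hU _ => ?_
    have := congrArg (fun k => k a (U ×ˢ S)) h'
    simpa [Kernel.compProd_apply_prod hU hS] using this
  change κ ⊗ₖ vcomp φ'.ker ψ.ker = κ ⊗ₖ vcomp φ'.ker ψ'.ker
  ext a : 1
  refine Measure.ext_prod (fun {U S} hU hS => ?_)
  rw [Kernel.compProd_apply_prod hU hS, Kernel.compProd_apply_prod hU hS]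
  refine lintegral_congr_ae (ae_restrict_of_ae ?_)
  have hk := key S hS a
  have hm : MeasurableSet {t | ψ.ker (a, t) S = ψ'.ker (a, t) S} :=
    measurableSet_eq_fun ((Kernel.measurable_coe _ hS).comp measurable_prodMk_left)
      ((Kernel.measurable_coe _ hS).comp measurable_prodMk_left)
  have h0 : ∫⁻ t, {t | ψ.ker (a, t) S = ψ'.ker (a, t) S}ᶜ.indicator 1 t ∂(κ' a) = 0 := by
    rw [lintegral_indicator_one hm.compl]; exact hk
  rw [φ'.lintegral_tgt _ (measurable_one.indicator hm.compl)] at h0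
  have hF : Measurable ({t | ψ.ker (a, t) S = ψ'.ker (a, t) S}ᶜ.indicator (1 : N × B → ℝ≥0∞)) :=
    measurable_one.indicator hm.compl
  rw [lintegral_eq_zero_iff (by fun_prop)] at h0
  filter_upwards [h0] with w hw
  rw [Pi.zero_apply, lintegral_eq_zero_iff (by fun_prop)] at hw
  have e : ∀ ψ : PreCell κ' κ'', (vcomp φ'.ker ψ.ker) (a, w) S =
      ∫⁻ n, ψ.ker (a, n, w.2) S ∂(φ'.ker (a, w)) := by
    intro ψ
    have := lintegral_vcomp φ'.ker ψ.ker a w (measurable_one.indicator hS)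
    simpa [lintegral_indicator_one hS] using this
  rw [e, e]
  refine lintegral_congr_ae ?_
  filter_upwards [hw] with n hn
  by_contra hne
  simp [hne] at hn


/-- Copy-composition of `κ` followed by `η`: the coparameter keeps a copy of the middle output. -/
noncomputable def seq (κ : Kernel A (M × B)) (η : Kernel B (N × C)) :
    Kernel A (((M × B) × N) × C) :=
  (κ ⊗ₖ η.comap (fun p : A × M × B => p.2.2) (by fun_prop)).map
    (fun t => ((t.1, t.2.1), t.2.2))

/-- Copy-composition of the backward kernels `σ` and then `ρ`. The coparameters are listed in the
order used by `seq`, so that the coparameters of the two parts of a composite lens coincide. -/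
noncomputable def bseq (ρ : Kernel B (M × A)) (σ : Kernel C (N × B)) :
    Kernel C (((M × B) × N) × A) :=
  (σ ⊗ₖ ρ.comap (fun p : C × N × B => p.2.2) (by fun_prop)).map
    (fun t => (((t.2.1, t.1.2), t.1.1), t.2.2))

instance (κ : Kernel A (M × B)) [IsMarkovKernel κ] (η : Kernel B (N × C)) [IsMarkovKernel η] :
    IsMarkovKernel (seq κ η) :=
  Kernel.IsMarkovKernel.map _ (by fun_prop)

instance (ρ : Kernel B (M × A)) [IsMarkovKernel ρ] (σ : Kernel C (N × B)) [IsMarkovKernel σ] :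
    IsMarkovKernel (bseq ρ σ) :=
  Kernel.IsMarkovKernel.map _ (by fun_prop)

theorem lintegral_seq (κ : Kernel A (M × B)) [IsMarkovKernel κ] (η : Kernel B (N × C))
    [IsMarkovKernel η] (a : A) {F : ((M × B) × N) × C → ℝ≥0∞} (hF : Measurable F) :
    ∫⁻ t, F t ∂(seq κ η a) = ∫⁻ w, ∫⁻ z, F ((w, z.1), z.2) ∂(η w.2) ∂(κ a) := by
  rw [seq, Kernel.map_apply _ (by fun_prop), lintegral_map hF (by fun_prop),
    Kernel.lintegral_compProd _ _ _ (by fun_prop)]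
  rfl

theorem lintegral_bseq (ρ : Kernel B (M × A)) [IsMarkovKernel ρ] (σ : Kernel C (N × B))
    [IsMarkovKernel σ] (c : C) {F : ((M × B) × N) × A → ℝ≥0∞} (hF : Measurable F) :
    ∫⁻ t, F t ∂(bseq ρ σ c) =
      ∫⁻ z, ∫⁻ w, F (((w.1, z.2), z.1), w.2) ∂(ρ z.2) ∂(σ c) := by
  rw [bseq, Kernel.map_apply _ (by fun_prop), lintegral_map hF (by fun_prop),
    Kernel.lintegral_compProd _ _ _ (by fun_prop)]
  rfl

/-- Whiskering a 2-cell on the second factor of `seq`. -/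
noncomputable def PreCell.seqLeft (κ : Kernel A (M × B)) [IsMarkovKernel κ]
    {η : Kernel B (N × C)} [IsMarkovKernel η] {η' : Kernel B (P × C)} [IsMarkovKernel η']
    (φ : PreCell η η') : PreCell (seq κ η) (seq κ η') where
  ker := lift φ.ker (fun t : A × ((M × B) × N) × C => (t.2.1.1.2, t.2.1.2, t.2.2)) (by fun_prop)
    (fun q => (q.1.2.1.1, q.2))
  markov := lift_isMarkov _ _ _ _ (by fun_prop)
  eq := by
    have := lift_isMarkov φ.ker
      (fun t : A × ((M × B) × N) × C => (t.2.1.1.2, t.2.1.2, t.2.2)) (by fun_prop)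
      (fun q => (q.1.2.1.1, q.2)) (by fun_prop)
    refine kernel_ext_lintegral fun a F hF => ?_
    rw [lintegral_push _ _ _ hF, lintegral_seq _ _ _ hF, lintegral_seq _ _ _ (by fun_prop)]
    refine lintegral_congr fun w => ?_
    rw [φ.lintegral_tgt _ (by fun_prop)]
    refine lintegral_congr fun z => ?_
    rw [lintegral_lift _ _ _ _ (by fun_prop) _ (by fun_prop)]

/-- Whiskering a 2-cell on the first factor of `seq`. -/
noncomputable def PreCell.seqRight {κ : Kernel A (M × B)} [IsMarkovKernel κ]
    {κ' : Kernel A (N × B)} [IsMarkovKernel κ'] (φ : PreCell κ κ')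
    (η : Kernel B (P × C)) [IsMarkovKernel η] : PreCell (seq κ η) (seq κ' η) where
  ker := lift φ.ker (fun t : A × ((M × B) × P) × C => (t.1, t.2.1.1)) (by fun_prop)
    (fun q => ((q.2, q.1.2.1.1.2), q.1.2.1.2))
  markov := lift_isMarkov _ _ _ _ (by fun_prop)
  eq := by
    have := lift_isMarkov φ.ker (fun t : A × ((M × B) × P) × C => (t.1, t.2.1.1)) (by fun_prop)
      (fun q => ((q.2, q.1.2.1.1.2), q.1.2.1.2)) (by fun_prop)
    refine kernel_ext_lintegral fun a F hF => ?_
    rw [lintegral_push _ _ _ hF, lintegral_seq _ _ _ hF, lintegral_seq _ _ _ (by fun_prop),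
      φ.lintegral_tgt _ (by fun_prop)]
    refine lintegral_congr fun w => ?_
    refine (lintegral_congr fun z => lintegral_lift _ _ _ _ (by fun_prop) _ (by fun_prop)).trans ?_
    dsimp only
    rw [lintegral_lintegral_swap]
    fun_prop

/-- Whiskering a 2-cell on the first channel applied in `bseq`. -/
noncomputable def PreCell.bseqLeft (ρ : Kernel B (M × A)) [IsMarkovKernel ρ]
    {σ : Kernel C (N × B)} [IsMarkovKernel σ] {σ' : Kernel C (P × B)} [IsMarkovKernel σ']
    (φ : PreCell σ σ') : PreCell (bseq ρ σ) (bseq ρ σ') where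
  ker := lift φ.ker (fun t : C × ((M × B) × N) × A => (t.1, t.2.1.2, t.2.1.1.2)) (by fun_prop)
    (fun q => (q.1.2.1.1, q.2))
  markov := lift_isMarkov _ _ _ _ (by fun_prop)
  eq := by
    have := lift_isMarkov φ.ker
      (fun t : C × ((M × B) × N) × A => (t.1, t.2.1.2, t.2.1.1.2)) (by fun_prop)
      (fun q => (q.1.2.1.1, q.2)) (by fun_prop)
    refine kernel_ext_lintegral fun a F hF => ?_
    rw [lintegral_push _ _ _ hF, lintegral_bseq _ _ _ hF, lintegral_bseq _ _ _ (by fun_prop),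
      φ.lintegral_tgt _ (by fun_prop)]
    refine lintegral_congr fun w => ?_
    refine (lintegral_congr fun z => lintegral_lift _ _ _ _ (by fun_prop) _ (by fun_prop)).trans ?_
    dsimp only
    rw [lintegral_lintegral_swap]
    fun_prop

/-- Whiskering a 2-cell on the last channel applied in `bseq`. -/
noncomputable def PreCell.bseqRight {ρ : Kernel B (M × A)} [IsMarkovKernel ρ]
    {ρ' : Kernel B (N × A)} [IsMarkovKernel ρ'] (φ : PreCell ρ ρ')
    {σ σ' : Kernel C (P × B)} [IsMarkovKernel σ] (h : σ = σ') :
    PreCell (bseq ρ σ) (bseq ρ' σ') where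
  ker := lift φ.ker (fun t : C × ((M × B) × P) × A => (t.2.1.1.2, t.2.1.1.1, t.2.2))
    (by fun_prop) (fun q => ((q.2, q.1.2.1.1.2), q.1.2.1.2))
  markov := lift_isMarkov _ _ _ _ (by fun_prop)
  eq := by
    have := lift_isMarkov φ.ker
      (fun t : C × ((M × B) × P) × A => (t.2.1.1.2, t.2.1.1.1, t.2.2)) (by fun_prop)
      (fun q => ((q.2, q.1.2.1.1.2), q.1.2.1.2)) (by fun_prop)
    subst h
    refine kernel_ext_lintegral fun a F hF => ?_
    rw [lintegral_push _ _ _ hF, lintegral_bseq _ _ _ hF, lintegral_bseq _ _ _ (by fun_prop)]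
    refine lintegral_congr fun w => ?_
    rw [φ.lintegral_tgt _ (by fun_prop)]
    refine lintegral_congr fun z => ?_
    rw [lintegral_lift _ _ _ _ (by fun_prop) _ (by fun_prop)]

theorem PreCell.seqLeft_congr (κ : Kernel A (M × B)) [IsMarkovKernel κ]
    {η : Kernel B (N × C)} [IsMarkovKernel η] {η' : Kernel B (P × C)} [IsMarkovKernel η']
    {φ ψ : PreCell η η'} (h : φ ≈ ψ) : φ.seqLeft κ ≈ ψ.seqLeft κ := by
  refine PreCell.rel_iff.2 fun a F hF => ?_
  have m1 := (φ.seqLeft κ).markov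
  have m2 := (ψ.seqLeft κ).markov
  rw [lintegral_seq _ _ _ (by fun_prop), lintegral_seq _ _ _ (by fun_prop)]
  refine lintegral_congr fun w => ?_
  have := PreCell.rel_iff.1 h w.2 (fun q => F (((w, q.1.1), q.1.2), (w, q.2))) (by fun_prop)
  convert this using 3 <;> exact lintegral_lift _ _ _ _ (by fun_prop) _ (by fun_prop)

theorem PreCell.seqRight_congr {κ : Kernel A (M × B)} [IsMarkovKernel κ]
    {κ' : Kernel A (N × B)} [IsMarkovKernel κ'] {φ ψ : PreCell κ κ'}
    (η : Kernel B (P × C)) [IsMarkovKernel η] (h : φ ≈ ψ) : φ.seqRight η ≈ ψ.seqRight η := by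
  refine PreCell.rel_iff.2 fun a F hF => ?_
  have m1 := (φ.seqRight η).markov
  have m2 := (ψ.seqRight η).markov
  rw [lintegral_seq _ _ _ (by fun_prop), lintegral_seq _ _ _ (by fun_prop)]
  have := PreCell.rel_iff.1 h a
    (fun q => ∫⁻ z, F (((q.1, z.1), z.2), ((q.2, q.1.2), z.1)) ∂(η q.1.2)) (by fun_prop)
  convert this using 3 with w w <;>
  · refine (lintegral_congr fun z => lintegral_lift _ _ _ _ (by fun_prop) _
      (by fun_prop)).trans ?_
    dsimp only
    rw [lintegral_lintegral_swap]
    fun_prop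

theorem PreCell.bseqLeft_congr (ρ : Kernel B (M × A)) [IsMarkovKernel ρ]
    {σ : Kernel C (N × B)} [IsMarkovKernel σ] {σ' : Kernel C (P × B)} [IsMarkovKernel σ']
    {φ ψ : PreCell σ σ'} (h : φ ≈ ψ) : φ.bseqLeft ρ ≈ ψ.bseqLeft ρ := by
  refine PreCell.rel_iff.2 fun a F hF => ?_
  have m1 := (φ.bseqLeft ρ).markov
  have m2 := (ψ.bseqLeft ρ).markov
  rw [lintegral_bseq _ _ _ (by fun_prop), lintegral_bseq _ _ _ (by fun_prop)]
  have := PreCell.rel_iff.1 h a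
    (fun q => ∫⁻ w, F ((((w.1, q.1.2), q.1.1), w.2), ((w.1, q.1.2), q.2)) ∂(ρ q.1.2))
    (by fun_prop)
  convert this using 3 with w w <;>
  · refine (lintegral_congr fun z => lintegral_lift _ _ _ _ (by fun_prop) _
      (by fun_prop)).trans ?_
    dsimp only
    rw [lintegral_lintegral_swap]
    fun_prop

theorem PreCell.bseqRight_congr {ρ : Kernel B (M × A)} [IsMarkovKernel ρ]
    {ρ' : Kernel B (N × A)} [IsMarkovKernel ρ'] {φ ψ : PreCell ρ ρ'}
    {σ σ' : Kernel C (P × B)} [IsMarkovKernel σ] (e : σ = σ') (h : φ ≈ ψ) :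
    φ.bseqRight e ≈ ψ.bseqRight e := by
  refine PreCell.rel_iff.2 fun a F hF => ?_
  have m1 := (φ.bseqRight e).markov
  have m2 := (ψ.bseqRight e).markov
  rw [lintegral_bseq _ _ _ (by fun_prop), lintegral_bseq _ _ _ (by fun_prop)]
  refine lintegral_congr fun w => ?_
  have := PreCell.rel_iff.1 h w.2
    (fun q => F ((((q.1.1, w.2), w.1), q.1.2), ((q.2, w.2), w.1))) (by fun_prop)
  convert this using 3 <;> exact lintegral_lift _ _ _ _ (by fun_prop) _ (by fun_prop)


/-! Operations on 2-cells. -/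

noncomputable def Cell.id (κ : Kernel A (M × B)) [IsMarkovKernel κ] : Cell κ κ := ⟦PreCell.id κ⟧

noncomputable def Cell.comp {κ : Kernel A (M × B)} [IsMarkovKernel κ] {κ' : Kernel A (N × B)}
    [IsMarkovKernel κ'] {κ'' : Kernel A (P × B)} : Cell κ κ' → Cell κ' κ'' → Cell κ κ'' :=
  Quotient.map₂ PreCell.comp fun _ _ h _ _ h' => PreCell.comp_congr h h'

noncomputable def Cell.seqLeft (κ : Kernel A (M × B)) [IsMarkovKernel κ]
    {η : Kernel B (N × C)} [IsMarkovKernel η] {η' : Kernel B (P × C)} [IsMarkovKernel η'] :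
    Cell η η' → Cell (seq κ η) (seq κ η') :=
  Quotient.map (PreCell.seqLeft κ) fun _ _ h => PreCell.seqLeft_congr κ h

noncomputable def Cell.seqRight {κ : Kernel A (M × B)} [IsMarkovKernel κ]
    {κ' : Kernel A (N × B)} [IsMarkovKernel κ'] (η : Kernel B (P × C)) [IsMarkovKernel η] :
    Cell κ κ' → Cell (seq κ η) (seq κ' η) :=
  Quotient.map (fun φ => PreCell.seqRight φ η) fun _ _ h => PreCell.seqRight_congr η h

noncomputable def Cell.bseqLeft (ρ : Kernel B (M × A)) [IsMarkovKernel ρ]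
    {σ : Kernel C (N × B)} [IsMarkovKernel σ] {σ' : Kernel C (P × B)} [IsMarkovKernel σ'] :
    Cell σ σ' → Cell (bseq ρ σ) (bseq ρ σ') :=
  Quotient.map (PreCell.bseqLeft ρ) fun _ _ h => PreCell.bseqLeft_congr ρ h

noncomputable def Cell.bseqRight {ρ : Kernel B (M × A)} [IsMarkovKernel ρ]
    {ρ' : Kernel B (N × A)} [IsMarkovKernel ρ'] {σ σ' : Kernel C (P × B)} [IsMarkovKernel σ]
    (e : σ = σ') : Cell ρ ρ' → Cell (bseq ρ σ) (bseq ρ' σ') :=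
  Quotient.map (fun φ => PreCell.bseqRight φ e) fun _ _ h => PreCell.bseqRight_congr e h

theorem Cell.mk_eq {κ : Kernel A (M × B)} {κ' : Kernel A (N × B)} {φ ψ : PreCell κ κ'}
    (h : ∀ p, ∀ F : N → ℝ≥0∞, Measurable F → ∫⁻ n, F n ∂(φ.ker p) = ∫⁻ n, F n ∂(ψ.ker p)) :
    (⟦φ⟧ : Cell κ κ') = ⟦ψ⟧ :=
  Quotient.sound (congrArg (κ ⊗ₖ ·) (kernel_ext_lintegral h))


theorem PreCell.lintegral_det_ker {κ : Kernel A (M × B)} [IsMarkovKernel κ]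
    {κ' : Kernel A (N × B)} {r : A × M × B → N} {hr : Measurable r}
    {h : ∀ a, ∀ F : N × B → ℝ≥0∞, Measurable F →
      ∫⁻ t, F t ∂(κ' a) = ∫⁻ w, F (r (a, w), w.2) ∂(κ a)} (p : A × M × B)
    {F : N → ℝ≥0∞} (hF : Measurable F) :
    ∫⁻ n, F n ∂((PreCell.det κ κ' r hr h).ker p) = F (r p) :=
  lintegral_det r hr p hF

theorem PreCell.lintegral_id_ker {κ : Kernel A (M × B)} [IsMarkovKernel κ] (p : A × M × B)
    {F : M → ℝ≥0∞} (hF : Measurable F) : ∫⁻ n, F n ∂((PreCell.id κ).ker p) = F p.2.1 :=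
  PreCell.lintegral_det_ker p hF

theorem PreCell.lintegral_comp_ker {κ : Kernel A (M × B)} [IsMarkovKernel κ]
    {κ' : Kernel A (N × B)} [IsMarkovKernel κ'] {κ'' : Kernel A (P × B)} (φ : PreCell κ κ')
    (ψ : PreCell κ' κ'') (p : A × M × B) {F : P → ℝ≥0∞} (hF : Measurable F) :
    ∫⁻ q, F q ∂((φ.comp ψ).ker p) =
      ∫⁻ n, ∫⁻ q, F q ∂(ψ.ker (p.1, n, p.2.2)) ∂(φ.ker p) :=
  lintegral_vcomp φ.ker ψ.ker p.1 p.2 hF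

/-- Conjugation of a 2-cell by two deterministic ones. -/
theorem PreCell.lintegral_conj {κ₀ : Kernel A (P × B)} [IsMarkovKernel κ₀]
    {κ : Kernel A (M × B)} [IsMarkovKernel κ] {κ' : Kernel A (N × B)} [IsMarkovKernel κ']
    {κ₁ : Kernel A (Q × B)} {r : A × P × B → M} {hr : Measurable r}
    {h : ∀ a, ∀ F : M × B → ℝ≥0∞, Measurable F →
      ∫⁻ t, F t ∂(κ a) = ∫⁻ w, F (r (a, w), w.2) ∂(κ₀ a)} (φ : PreCell κ κ')
    {r' : A × N × B → Q} {hr' : Measurable r'}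
    {h' : ∀ a, ∀ F : Q × B → ℝ≥0∞, Measurable F →
      ∫⁻ t, F t ∂(κ₁ a) = ∫⁻ w, F (r' (a, w), w.2) ∂(κ' a)} (p : A × P × B)
    {F : Q → ℝ≥0∞} (hF : Measurable F) :
    ∫⁻ q, F q ∂(((PreCell.det κ₀ κ r hr h).comp (φ.comp (PreCell.det κ' κ₁ r' hr' h'))).ker p) =
      ∫⁻ n, F (r' (p.1, n, p.2.2)) ∂(φ.ker (p.1, r p, p.2.2)) := by
  rw [PreCell.lintegral_comp_ker _ _ _ hF, PreCell.lintegral_det_ker _ (by fun_prop),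
    PreCell.lintegral_comp_ker _ _ _ hF]
  exact lintegral_congr fun n => PreCell.lintegral_det_ker _ hF

theorem PreCell.lintegral_seqLeft (κ : Kernel A (M × B)) [IsMarkovKernel κ]
    {η : Kernel B (N × C)} [IsMarkovKernel η] {η' : Kernel B (P × C)} [IsMarkovKernel η']
    (φ : PreCell η η') (p : A × ((M × B) × N) × C) {F : (M × B) × P → ℝ≥0∞}
    (hF : Measurable F) :
    ∫⁻ q, F q ∂((φ.seqLeft κ).ker p) =
      ∫⁻ n, F (p.2.1.1, n) ∂(φ.ker (p.2.1.1.2, p.2.1.2, p.2.2)) :=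
  lintegral_lift _ _ _ _ (by fun_prop) _ hF

theorem PreCell.lintegral_seqRight {κ : Kernel A (M × B)} [IsMarkovKernel κ]
    {κ' : Kernel A (N × B)} [IsMarkovKernel κ'] (φ : PreCell κ κ')
    (η : Kernel B (P × C)) [IsMarkovKernel η] (p : A × ((M × B) × P) × C)
    {F : (N × B) × P → ℝ≥0∞} (hF : Measurable F) :
    ∫⁻ q, F q ∂((φ.seqRight η).ker p) =
      ∫⁻ n, F ((n, p.2.1.1.2), p.2.1.2) ∂(φ.ker (p.1, p.2.1.1)) :=
  lintegral_lift _ _ _ _ (by fun_prop) _ hF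

theorem PreCell.lintegral_bseqLeft (ρ : Kernel B (M × A)) [IsMarkovKernel ρ]
    {σ : Kernel C (N × B)} [IsMarkovKernel σ] {σ' : Kernel C (P × B)} [IsMarkovKernel σ']
    (φ : PreCell σ σ') (p : C × ((M × B) × N) × A) {F : (M × B) × P → ℝ≥0∞}
    (hF : Measurable F) :
    ∫⁻ q, F q ∂((φ.bseqLeft ρ).ker p) =
      ∫⁻ n, F (p.2.1.1, n) ∂(φ.ker (p.1, p.2.1.2, p.2.1.1.2)) :=
  lintegral_lift _ _ _ _ (by fun_prop) _ hF

theorem PreCell.lintegral_bseqRight {ρ : Kernel B (M × A)} [IsMarkovKernel ρ]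
    {ρ' : Kernel B (N × A)} [IsMarkovKernel ρ'] (φ : PreCell ρ ρ')
    {σ σ' : Kernel C (P × B)} [IsMarkovKernel σ] (e : σ = σ')
    (p : C × ((M × B) × P) × A) {F : (N × B) × P → ℝ≥0∞} (hF : Measurable F) :
    ∫⁻ q, F q ∂((φ.bseqRight e).ker p) =
      ∫⁻ n, F ((n, p.2.1.1.2), p.2.1.2) ∂(φ.ker (p.2.1.1.2, p.2.1.1.1, p.2.2)) :=
  lintegral_lift _ _ _ _ (by fun_prop) _ hF


theorem lintegral_seq_assoc (κ : Kernel A (M × B)) [IsMarkovKernel κ] (η : Kernel B (N × C))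
    [IsMarkovKernel η] (θ : Kernel C (P × D)) [IsMarkovKernel θ] (a : A)
    {F : ((M × B) × (N × C) × P) × D → ℝ≥0∞} (hF : Measurable F) :
    ∫⁻ t, F t ∂(seq κ (seq η θ) a) =
      ∫⁻ w, F ((w.1.1.1.1, ((w.1.1.1.2, w.1.1.2), w.1.2)), w.2) ∂(seq (seq κ η) θ a) := by
  rw [lintegral_seq _ _ _ hF, lintegral_seq _ _ _ (by fun_prop),
    lintegral_seq _ _ _ (by fun_prop)]
  exact lintegral_congr fun w => lintegral_seq _ _ _ (by fun_prop)

theorem lintegral_seq_assoc' (κ : Kernel A (M × B)) [IsMarkovKernel κ] (η : Kernel B (N × C))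
    [IsMarkovKernel η] (θ : Kernel C (P × D)) [IsMarkovKernel θ] (a : A)
    {F : ((((M × B) × N) × C) × P) × D → ℝ≥0∞} (hF : Measurable F) :
    ∫⁻ t, F t ∂(seq (seq κ η) θ a) =
      ∫⁻ w, F ((((w.1.1, w.1.2.1.1), w.1.2.1.2), w.1.2.2), w.2) ∂(seq κ (seq η θ) a) := by
  rw [lintegral_seq_assoc κ η θ a (by fun_prop)]

theorem lintegral_bseq_assoc (ρ : Kernel B (M × A)) [IsMarkovKernel ρ] (σ : Kernel C (N × B))
    [IsMarkovKernel σ] (τ : Kernel D (P × C)) [IsMarkovKernel τ] (d : D)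
    {F : ((M × B) × (N × C) × P) × A → ℝ≥0∞} (hF : Measurable F) :
    ∫⁻ t, F t ∂(bseq ρ (bseq σ τ) d) =
      ∫⁻ w, F ((w.1.1.1.1, ((w.1.1.1.2, w.1.1.2), w.1.2)), w.2) ∂(bseq (bseq ρ σ) τ d) := by
  rw [lintegral_bseq _ _ _ hF, lintegral_bseq _ _ _ (by fun_prop),
    lintegral_bseq _ _ _ (by fun_prop)]
  refine lintegral_congr fun w => ?_
  rw [lintegral_bseq _ _ _ (by fun_prop)]

theorem lintegral_bseq_assoc' (ρ : Kernel B (M × A)) [IsMarkovKernel ρ] (σ : Kernel C (N × B))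
    [IsMarkovKernel σ] (τ : Kernel D (P × C)) [IsMarkovKernel τ] (d : D)
    {F : ((((M × B) × N) × C) × P) × A → ℝ≥0∞} (hF : Measurable F) :
    ∫⁻ t, F t ∂(bseq (bseq ρ σ) τ d) =
      ∫⁻ w, F ((((w.1.1, w.1.2.1.1), w.1.2.1.2), w.1.2.2), w.2) ∂(bseq ρ (bseq σ τ) d) := by
  rw [lintegral_bseq_assoc ρ σ τ d (by fun_prop)]

/-- The identity channel, with trivial coparameter. -/
noncomputable def idKer (A : Type u) [MeasurableSpace A] : Kernel A (PUnit.{u + 1} × A) :=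
  Kernel.deterministic (fun a => (PUnit.unit, a)) (by fun_prop)

instance : IsMarkovKernel (idKer A) := by unfold idKer; infer_instance

theorem lintegral_idKer (a : A) {F : PUnit.{u + 1} × A → ℝ≥0∞} (hF : Measurable F) :
    ∫⁻ t, F t ∂(idKer A a) = F (PUnit.unit, a) :=
  lintegral_det _ _ _ hF

theorem lintegral_seq_id_left (κ : Kernel A (M × B)) [IsMarkovKernel κ] (a : A)
    {F : ((PUnit.{u + 1} × A) × M) × B → ℝ≥0∞} (hF : Measurable F) :
    ∫⁻ t, F t ∂(seq (idKer A) κ a) = ∫⁻ w, F (((PUnit.unit, a), w.1), w.2) ∂(κ a) := by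
  rw [lintegral_seq _ _ _ hF, lintegral_idKer _ (by fun_prop)]

theorem lintegral_seq_id_right (κ : Kernel A (M × B)) [IsMarkovKernel κ] (a : A)
    {F : ((M × B) × PUnit.{u + 1}) × B → ℝ≥0∞} (hF : Measurable F) :
    ∫⁻ t, F t ∂(seq κ (idKer B) a) = ∫⁻ w, F ((w, PUnit.unit), w.2) ∂(κ a) := by
  rw [lintegral_seq _ _ _ hF]
  exact lintegral_congr fun w => lintegral_idKer _ (by fun_prop)

theorem lintegral_bseq_id_left (σ : Kernel B (M × A)) [IsMarkovKernel σ] (b : B)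
    {F : ((PUnit.{u + 1} × A) × M) × A → ℝ≥0∞} (hF : Measurable F) :
    ∫⁻ t, F t ∂(bseq (idKer A) σ b) = ∫⁻ w, F (((PUnit.unit, w.2), w.1), w.2) ∂(σ b) := by
  rw [lintegral_bseq _ _ _ hF]
  exact lintegral_congr fun w => lintegral_idKer _ (by fun_prop)

theorem lintegral_bseq_id_right (ρ : Kernel B (M × A)) [IsMarkovKernel ρ] (b : B)
    {F : ((M × B) × PUnit.{u + 1}) × A → ℝ≥0∞} (hF : Measurable F) :
    ∫⁻ t, F t ∂(bseq ρ (idKer B) b) = ∫⁻ w, F (((w.1, b), PUnit.unit), w.2) ∂(ρ b) := by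
  rw [lintegral_bseq _ _ _ hF, lintegral_idKer _ (by fun_prop)]


/-- Two deterministic 2-cells compose to the identity if they do so almost surely. -/
theorem Cell.det_comp_det {κ : Kernel A (M × B)} [IsMarkovKernel κ] {κ' : Kernel A (N × B)}
    [IsMarkovKernel κ'] {r : A × M × B → N} {hr : Measurable r}
    {h : ∀ a, ∀ F : N × B → ℝ≥0∞, Measurable F →
      ∫⁻ t, F t ∂(κ' a) = ∫⁻ w, F (r (a, w), w.2) ∂(κ a)}
    {s : A × N × B → M} {hs : Measurable s}
    {h' : ∀ a, ∀ F : M × B → ℝ≥0∞, Measurable F →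
      ∫⁻ t, F t ∂(κ a) = ∫⁻ w, F (s (a, w), w.2) ∂(κ' a)}
    (H : ∀ a, ∀ F : (M × B) × M → ℝ≥0∞, Measurable F →
      ∫⁻ w, F (w, s (a, r (a, w), w.2)) ∂(κ a) = ∫⁻ w, F (w, w.1) ∂(κ a)) :
    Cell.comp (⟦PreCell.det κ κ' r hr h⟧ : Cell κ κ') ⟦PreCell.det κ' κ s hs h'⟧ = Cell.id κ := by
  refine Quotient.sound (PreCell.rel_iff.2 fun a F hF => ?_)
  refine Eq.trans (lintegral_congr fun w => ?_) ((H a F hF).trans (lintegral_congr fun w => ?_))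
  · rw [PreCell.lintegral_comp_ker _ _ _ (by fun_prop), PreCell.lintegral_det_ker _ (by fun_prop),
      PreCell.lintegral_det_ker _ (by fun_prop)]
  · rw [PreCell.lintegral_id_ker _ (by fun_prop)]


section Laws

set_option linter.unusedSectionVars false
set_option linter.unusedVariables false

set_option linter.unusedSimpArgs false

variable {κ : Kernel A (M × B)} [IsMarkovKernel κ] {κ' : Kernel A (N × B)} [IsMarkovKernel κ']
  {κ'' : Kernel A (P × B)} [IsMarkovKernel κ'']

theorem seqLeft_id {η : Kernel B (N × C)} [IsMarkovKernel η] (p : A × ((M × B) × N) × C)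
    (F : (M × B) × N → ℝ≥0∞) (hF : Measurable F) :
    ∫⁻ q, F q ∂(((PreCell.id η).seqLeft κ).ker p) =
      ∫⁻ q, F q ∂((PreCell.id (seq κ η)).ker p) := by
  simp (disch := fun_prop) only [PreCell.lintegral_seqLeft, PreCell.lintegral_seqRight,
    PreCell.lintegral_bseqLeft, PreCell.lintegral_bseqRight, PreCell.lintegral_comp_ker,
    PreCell.lintegral_id_ker]

theorem bseqLeft_id {σ : Kernel C (N × A)} [IsMarkovKernel σ] (p : C × ((M × A) × N) × B)
    (ρ : Kernel A (M × B)) [IsMarkovKernel ρ] (F : (M × A) × N → ℝ≥0∞) (hF : Measurable F) :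
    ∫⁻ q, F q ∂(((PreCell.id σ).bseqLeft ρ).ker p) =
      ∫⁻ q, F q ∂((PreCell.id (bseq ρ σ)).ker p) := by
  simp (disch := fun_prop) only [PreCell.lintegral_seqLeft, PreCell.lintegral_seqRight,
    PreCell.lintegral_bseqLeft, PreCell.lintegral_bseqRight, PreCell.lintegral_comp_ker,
    PreCell.lintegral_id_ker]

theorem seqRight_id {η : Kernel B (N × C)} [IsMarkovKernel η] (p : A × ((M × B) × N) × C)
    (F : (M × B) × N → ℝ≥0∞) (hF : Measurable F) :
    ∫⁻ q, F q ∂(((PreCell.id κ).seqRight η).ker p) =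
      ∫⁻ q, F q ∂((PreCell.id (seq κ η)).ker p) := by
  simp (disch := fun_prop) only [PreCell.lintegral_seqLeft, PreCell.lintegral_seqRight,
    PreCell.lintegral_bseqLeft, PreCell.lintegral_bseqRight, PreCell.lintegral_comp_ker,
    PreCell.lintegral_id_ker]

theorem bseqRight_id {σ : Kernel C (N × A)} [IsMarkovKernel σ] (p : C × ((M × A) × N) × B)
    (ρ : Kernel A (M × B)) [IsMarkovKernel ρ] (F : (M × A) × N → ℝ≥0∞) (hF : Measurable F) :
    ∫⁻ q, F q ∂(((PreCell.id ρ).bseqRight (Eq.refl σ)).ker p) =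
      ∫⁻ q, F q ∂((PreCell.id (bseq ρ σ)).ker p) := by
  simp (disch := fun_prop) only [PreCell.lintegral_seqLeft, PreCell.lintegral_seqRight,
    PreCell.lintegral_bseqLeft, PreCell.lintegral_bseqRight, PreCell.lintegral_comp_ker,
    PreCell.lintegral_id_ker]

theorem seqLeft_comp (φ : PreCell κ κ') (ψ : PreCell κ' κ'') (θ : Kernel D (Q × A))
    [IsMarkovKernel θ] (p : D × ((Q × A) × M) × B) (F : (Q × A) × P → ℝ≥0∞)
    (hF : Measurable F) :
    ∫⁻ q, F q ∂(((φ.comp ψ).seqLeft θ).ker p) =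
      ∫⁻ q, F q ∂(((φ.seqLeft θ).comp (ψ.seqLeft θ)).ker p) := by
  simp (disch := fun_prop) only [PreCell.lintegral_seqLeft, PreCell.lintegral_seqRight,
    PreCell.lintegral_bseqLeft, PreCell.lintegral_bseqRight, PreCell.lintegral_comp_ker,
    PreCell.lintegral_id_ker]

theorem bseqLeft_comp (φ : PreCell κ κ') (ψ : PreCell κ' κ'') (θ : Kernel B (Q × D))
    [IsMarkovKernel θ] (p : A × ((Q × B) × M) × D) (F : (Q × B) × P → ℝ≥0∞)
    (hF : Measurable F) :
    ∫⁻ q, F q ∂(((φ.comp ψ).bseqLeft θ).ker p) =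
      ∫⁻ q, F q ∂(((φ.bseqLeft θ).comp (ψ.bseqLeft θ)).ker p) := by
  simp (disch := fun_prop) only [PreCell.lintegral_seqLeft, PreCell.lintegral_seqRight,
    PreCell.lintegral_bseqLeft, PreCell.lintegral_bseqRight, PreCell.lintegral_comp_ker,
    PreCell.lintegral_id_ker]

theorem seqRight_comp (φ : PreCell κ κ') (ψ : PreCell κ' κ'') (θ : Kernel B (Q × D))
    [IsMarkovKernel θ] (p : A × ((M × B) × Q) × D) (F : (P × B) × Q → ℝ≥0∞)
    (hF : Measurable F) :
    ∫⁻ q, F q ∂(((φ.comp ψ).seqRight θ).ker p) =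
      ∫⁻ q, F q ∂(((φ.seqRight θ).comp (ψ.seqRight θ)).ker p) := by
  simp (disch := fun_prop) only [PreCell.lintegral_seqLeft, PreCell.lintegral_seqRight,
    PreCell.lintegral_bseqLeft, PreCell.lintegral_bseqRight, PreCell.lintegral_comp_ker,
    PreCell.lintegral_id_ker]

theorem bseqRight_comp (φ : PreCell κ κ') (ψ : PreCell κ' κ'') {σ σ' σ'' : Kernel D (Q × A)}
    [IsMarkovKernel σ] [IsMarkovKernel σ'] (e : σ = σ') (e' : σ' = σ'') (e'' : σ = σ'')
    (p : D × ((M × A) × Q) × B) (F : (P × A) × Q → ℝ≥0∞) (hF : Measurable F) :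
    ∫⁻ q, F q ∂(((φ.comp ψ).bseqRight e'').ker p) =
      ∫⁻ q, F q ∂(((φ.bseqRight e).comp (ψ.bseqRight e')).ker p) := by
  simp (disch := fun_prop) only [PreCell.lintegral_seqLeft, PreCell.lintegral_seqRight,
    PreCell.lintegral_bseqLeft, PreCell.lintegral_bseqRight, PreCell.lintegral_comp_ker,
    PreCell.lintegral_id_ker]

theorem exchange_seq {R : Type u} [MeasurableSpace R] (φ : PreCell κ κ')
    {η : Kernel B (Q × C)} [IsMarkovKernel η] {η' : Kernel B (R × C)} [IsMarkovKernel η']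
    (ψ : PreCell η η') (p : A × ((M × B) × Q) × C) (F : (N × B) × R → ℝ≥0∞)
    (hF : Measurable F) :
    ∫⁻ q, F q ∂(((ψ.seqLeft κ).comp (φ.seqRight η')).ker p) =
      ∫⁻ q, F q ∂(((φ.seqRight η).comp (ψ.seqLeft κ')).ker p) := by
  simp (disch := fun_prop) only [PreCell.lintegral_seqLeft, PreCell.lintegral_seqRight,
    PreCell.lintegral_comp_ker]
  rw [lintegral_lintegral_swap]
  fun_prop

theorem exchange_bseq {R : Type u} [MeasurableSpace R] (φ : PreCell κ κ')
    {σ₁ σ₂ : Kernel C (Q × A)} [IsMarkovKernel σ₁] [IsMarkovKernel σ₂]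
    {τ₁ τ₂ : Kernel C (R × A)} [IsMarkovKernel τ₁] [IsMarkovKernel τ₂]
    (ψ : PreCell σ₁ τ₁) (ψ' : PreCell σ₂ τ₂) (e : σ₁ = σ₂) (e' : τ₁ = τ₂)
    (hψ : ψ.ker = ψ'.ker)
    (p : C × ((M × A) × Q) × B) (F : (N × A) × R → ℝ≥0∞) (hF : Measurable F) :
    ∫⁻ q, F q ∂(((ψ.bseqLeft κ).comp (φ.bseqRight e')).ker p) =
      ∫⁻ q, F q ∂(((φ.bseqRight e).comp (ψ'.bseqLeft κ')).ker p) := by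
  simp (disch := fun_prop) only [PreCell.lintegral_bseqLeft, PreCell.lintegral_bseqRight,
    PreCell.lintegral_comp_ker, ← hψ]
  rw [lintegral_lintegral_swap]
  fun_prop

theorem seqLeft_seq (φ : PreCell κ κ') (θ : Kernel C (P × D)) [IsMarkovKernel θ]
    (ζ : Kernel D (Q × A)) [IsMarkovKernel ζ] (p : C × ((((P × D) × Q) × A) × M) × B)
    (F : (((P × D) × Q) × A) × N → ℝ≥0∞) (hF : Measurable F) :
    ∫⁻ q, F q ∂((φ.seqLeft (seq θ ζ)).ker p) =
      ∫⁻ n, F (((n.1, n.2.1.1), n.2.1.2), n.2.2) ∂(((φ.seqLeft ζ).seqLeft θ).ker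
        (p.1, (p.2.1.1.1.1, ((p.2.1.1.1.2, p.2.1.1.2), p.2.1.2)), p.2.2)) := by
  simp (disch := fun_prop) only [PreCell.lintegral_seqLeft, PreCell.lintegral_seqRight,
    PreCell.lintegral_bseqLeft, PreCell.lintegral_bseqRight, PreCell.lintegral_comp_ker,
    PreCell.lintegral_id_ker]

theorem bseqLeft_bseq {κ₁ : Kernel A (M × B)} [IsMarkovKernel κ₁] {κ₁' : Kernel A (N × B)}
    [IsMarkovKernel κ₁'] (φ₁ : PreCell κ₁ κ₁') (φ : PreCell κ κ') (hφ : φ₁.ker = φ.ker) (θ : Kernel D (P × C)) [IsMarkovKernel θ]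
    (ζ : Kernel B (Q × D)) [IsMarkovKernel ζ] (p : A × ((((P × D) × Q) × B) × M) × C)
    (F : (((P × D) × Q) × B) × N → ℝ≥0∞) (hF : Measurable F) :
    ∫⁻ q, F q ∂((φ₁.bseqLeft (bseq θ ζ)).ker p) =
      ∫⁻ n, F (((n.1, n.2.1.1), n.2.1.2), n.2.2) ∂(((φ.bseqLeft ζ).bseqLeft θ).ker
        (p.1, (p.2.1.1.1.1, ((p.2.1.1.1.2, p.2.1.1.2), p.2.1.2)), p.2.2)) := by
  simp (disch := fun_prop) only [PreCell.lintegral_bseqLeft, hφ]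

theorem seqRight_seq (φ : PreCell κ κ') (θ : Kernel B (P × C)) [IsMarkovKernel θ]
    (ζ : Kernel C (Q × D)) [IsMarkovKernel ζ] (p : A × ((M × B) × (P × C) × Q) × D)
    (F : (N × B) × (P × C) × Q → ℝ≥0∞) (hF : Measurable F) :
    ∫⁻ q, F q ∂((φ.seqRight (seq θ ζ)).ker p) =
      ∫⁻ n, F (n.1.1.1, ((n.1.1.2, n.1.2), n.2)) ∂(((φ.seqRight θ).seqRight ζ).ker
        (p.1, (((p.2.1.1, p.2.1.2.1.1), p.2.1.2.1.2), p.2.1.2.2), p.2.2)) := by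
  simp (disch := fun_prop) only [PreCell.lintegral_seqLeft, PreCell.lintegral_seqRight,
    PreCell.lintegral_bseqLeft, PreCell.lintegral_bseqRight, PreCell.lintegral_comp_ker,
    PreCell.lintegral_id_ker]

theorem seqMiddle (φ : PreCell κ κ') (θ : Kernel C (P × A)) [IsMarkovKernel θ]
    (ζ : Kernel B (Q × D)) [IsMarkovKernel ζ] (p : C × ((((P × A) × M) × B) × Q) × D)
    (F : (((P × A) × N) × B) × Q → ℝ≥0∞) (hF : Measurable F) :
    ∫⁻ q, F q ∂(((φ.seqLeft θ).seqRight ζ).ker p) =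
      ∫⁻ n, F (((n.1, n.2.1.1), n.2.1.2), n.2.2) ∂(((φ.seqRight ζ).seqLeft θ).ker
        (p.1, (p.2.1.1.1.1, ((p.2.1.1.1.2, p.2.1.1.2), p.2.1.2)), p.2.2)) := by
  simp (disch := fun_prop) only [PreCell.lintegral_seqLeft, PreCell.lintegral_seqRight,
    PreCell.lintegral_bseqLeft, PreCell.lintegral_bseqRight, PreCell.lintegral_comp_ker,
    PreCell.lintegral_id_ker]

theorem bseqRight_bseq (φ : PreCell κ κ') {σ σ' : Kernel C (P × A)} [IsMarkovKernel σ]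
    {τ τ' : Kernel D (Q × C)} [IsMarkovKernel τ] [IsMarkovKernel τ'] [IsMarkovKernel σ']
    {υ υ' : Kernel D (((P × C) × Q) × A)} (hυ : IsMarkovKernel υ)
    (e : σ = σ') (e' : τ = τ') (e'' : υ = υ')
    (p : D × ((M × A) × (P × C) × Q) × B) (F : (N × A) × (P × C) × Q → ℝ≥0∞)
    (hF : Measurable F) :
    ∫⁻ q, F q ∂((φ.bseqRight e'').ker p) =
      ∫⁻ n, F (n.1.1.1, ((n.1.1.2, n.1.2), n.2)) ∂(((φ.bseqRight e).bseqRight e').ker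
        (p.1, (((p.2.1.1, p.2.1.2.1.1), p.2.1.2.1.2), p.2.1.2.2), p.2.2)) := by
  simp (disch := fun_prop) only [PreCell.lintegral_bseqLeft, PreCell.lintegral_bseqRight]

theorem bseqMiddle (φ : PreCell κ κ') (θ : Kernel B (P × C)) [IsMarkovKernel θ]
    {σ σ' σ₁ σ₁' : Kernel D (Q × A)} [IsMarkovKernel σ] [IsMarkovKernel σ'] [IsMarkovKernel σ₁]
    [IsMarkovKernel σ₁'] (e : σ = σ') (e₁ : σ₁ = σ₁')
    (p : D × ((((P × B) × M) × A) × Q) × C)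
    (F : (((P × B) × N) × A) × Q → ℝ≥0∞) (hF : Measurable F) :
    ∫⁻ q, F q ∂(((φ.bseqLeft θ).bseqRight e).ker p) =
      ∫⁻ n, F (((n.1, n.2.1.1), n.2.1.2), n.2.2) ∂(((φ.bseqRight e₁).bseqLeft θ).ker
        (p.1, (p.2.1.1.1.1, ((p.2.1.1.1.2, p.2.1.1.2), p.2.1.2)), p.2.2)) := by
  simp (disch := fun_prop) only [PreCell.lintegral_bseqLeft, PreCell.lintegral_bseqRight]

theorem id_seqLeft (φ : PreCell κ κ') 
    {hr : Measurable (fun p : A × ((PUnit.{u + 1} × A) × M) × B => p.2.1.2)}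
    {h : ∀ a, ∀ F : M × B → ℝ≥0∞, Measurable F →
      ∫⁻ t, F t ∂(κ a) = ∫⁻ w, F ((fun p : A × ((PUnit.{u + 1} × A) × M) × B => p.2.1.2) (a, w), w.2) ∂(seq (idKer A) κ a)}
    {hs : Measurable (fun p : A × N × B => ((PUnit.unit.{u + 1}, p.1), p.2.1))}
    {h' : ∀ a, ∀ F : ((PUnit.{u + 1} × A) × N) × B → ℝ≥0∞, Measurable F →
      ∫⁻ t, F t ∂(seq (idKer A) κ' a) = ∫⁻ w, F ((fun p : A × N × B => ((PUnit.unit.{u + 1}, p.1), p.2.1)) (a, w), w.2) ∂(κ' a)} :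
    φ.seqLeft (idKer A) ≈ (PreCell.det (seq (idKer A) κ) κ (fun p => p.2.1.2) hr h).comp
      (φ.comp (PreCell.det κ' (seq (idKer A) κ') (fun p => ((PUnit.unit.{u + 1}, p.1), p.2.1)) hs h')) := by
  refine PreCell.rel_iff.2 fun a F hF => ?_
  have m1 := (φ.seqLeft (idKer A)).markov
  rw [lintegral_seq_id_left _ _ (by fun_prop), lintegral_seq_id_left _ _ (by fun_prop)]
  refine lintegral_congr fun w => ?_
  rw [PreCell.lintegral_seqLeft _ _ _ (by fun_prop), PreCell.lintegral_conj _ _ (by fun_prop)]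

theorem id_bseqLeft (φ : PreCell κ κ') {κ₁ : Kernel A (M × B)} [IsMarkovKernel κ₁]
    {κ₁' : Kernel A (N × B)} [IsMarkovKernel κ₁'] (φ₁ : PreCell κ₁ κ₁') (e : κ₁ = κ) (e' : κ₁' = κ')
    (hφ : φ₁.ker = φ.ker)
    {hr : Measurable (fun p : A × ((PUnit.{u + 1} × B) × M) × B => p.2.1.2)}
    {h : ∀ a, ∀ F : M × B → ℝ≥0∞, Measurable F →
      ∫⁻ t, F t ∂(κ a) = ∫⁻ w, F ((fun p : A × ((PUnit.{u + 1} × B) × M) × B => p.2.1.2) (a, w), w.2) ∂(bseq (idKer B) κ₁ a)}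
    {hs : Measurable (fun p : A × N × B => ((PUnit.unit.{u + 1}, p.2.2), p.2.1))}
    {h' : ∀ a, ∀ F : ((PUnit.{u + 1} × B) × N) × B → ℝ≥0∞, Measurable F →
      ∫⁻ t, F t ∂(bseq (idKer B) κ₁' a) = ∫⁻ w, F ((fun p : A × N × B => ((PUnit.unit.{u + 1}, p.2.2), p.2.1)) (a, w), w.2) ∂(κ' a)} :
    φ₁.bseqLeft (idKer B) ≈ (PreCell.det (bseq (idKer B) κ₁) κ (fun p => p.2.1.2) hr h).comp
      (φ.comp (PreCell.det κ' (bseq (idKer B) κ₁') (fun p => ((PUnit.unit.{u + 1}, p.2.2), p.2.1)) hs h')) := by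
  subst e e'
  refine PreCell.rel_iff.2 fun a F hF => ?_
  have m1 := (φ₁.bseqLeft (idKer B)).markov
  rw [lintegral_bseq_id_left _ _ (by fun_prop), lintegral_bseq_id_left _ _ (by fun_prop)]
  refine lintegral_congr fun w => ?_
  rw [PreCell.lintegral_bseqLeft _ _ _ (by fun_prop), PreCell.lintegral_conj _ _ (by fun_prop),
    hφ]

theorem seqRight_idKer (φ : PreCell κ κ') 
    {hr : Measurable (fun p : A × ((M × B) × PUnit.{u + 1}) × B => p.2.1.1.1)}
    {h : ∀ a, ∀ F : M × B → ℝ≥0∞, Measurable F →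
      ∫⁻ t, F t ∂(κ a) = ∫⁻ w, F ((fun p : A × ((M × B) × PUnit.{u + 1}) × B => p.2.1.1.1) (a, w), w.2) ∂(seq κ (idKer B) a)}
    {hs : Measurable (fun p : A × N × B => ((p.2.1, p.2.2), PUnit.unit.{u + 1}))}
    {h' : ∀ a, ∀ F : ((N × B) × PUnit.{u + 1}) × B → ℝ≥0∞, Measurable F →
      ∫⁻ t, F t ∂(seq κ' (idKer B) a) = ∫⁻ w, F ((fun p : A × N × B => ((p.2.1, p.2.2), PUnit.unit.{u + 1})) (a, w), w.2) ∂(κ' a)} :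
    φ.seqRight (idKer B) ≈ (PreCell.det (seq κ (idKer B)) κ (fun p => p.2.1.1.1) hr h).comp
      (φ.comp (PreCell.det κ' (seq κ' (idKer B)) (fun p => ((p.2.1, p.2.2), PUnit.unit.{u + 1})) hs h')) := by
  refine PreCell.rel_iff.2 fun a F hF => ?_
  have m1 := (φ.seqRight (idKer B)).markov
  rw [lintegral_seq_id_right _ _ (by fun_prop), lintegral_seq_id_right _ _ (by fun_prop)]
  refine lintegral_congr fun w => ?_
  rw [PreCell.lintegral_seqRight _ _ _ (by fun_prop), PreCell.lintegral_conj _ _ (by fun_prop)]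

theorem bseqRight_idKer (φ : PreCell κ κ') (e : idKer A = idKer A)
    {hr : Measurable (fun p : A × ((M × A) × PUnit.{u + 1}) × B => p.2.1.1.1)}
    {h : ∀ a, ∀ F : M × B → ℝ≥0∞, Measurable F →
      ∫⁻ t, F t ∂(κ a) = ∫⁻ w, F ((fun p : A × ((M × A) × PUnit.{u + 1}) × B => p.2.1.1.1) (a, w), w.2) ∂(bseq κ (idKer A) a)}
    {hs : Measurable (fun p : A × N × B => ((p.2.1, p.1), PUnit.unit.{u + 1}))}
    {h' : ∀ a, ∀ F : ((N × A) × PUnit.{u + 1}) × B → ℝ≥0∞, Measurable F →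
      ∫⁻ t, F t ∂(bseq κ' (idKer A) a) = ∫⁻ w, F ((fun p : A × N × B => ((p.2.1, p.1), PUnit.unit.{u + 1})) (a, w), w.2) ∂(κ' a)} :
    φ.bseqRight e ≈ (PreCell.det (bseq κ (idKer A)) κ (fun p => p.2.1.1.1) hr h).comp
      (φ.comp (PreCell.det κ' (bseq κ' (idKer A)) (fun p => ((p.2.1, p.1), PUnit.unit.{u + 1})) hs h')) := by
  refine PreCell.rel_iff.2 fun a F hF => ?_
  have m1 := (φ.bseqRight e).markov
  rw [lintegral_bseq_id_right _ _ (by fun_prop), lintegral_bseq_id_right _ _ (by fun_prop)]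
  refine lintegral_congr fun w => ?_
  rw [PreCell.lintegral_bseqRight _ _ _ (by fun_prop), PreCell.lintegral_conj _ _ (by fun_prop)]

/-- The kernel of a 2-cell is given by the function `r`. -/
def PreCell.IsDet (φ : PreCell κ κ') (r : A × M × B → N) : Prop :=
  ∀ p, ∀ F : N → ℝ≥0∞, Measurable F → ∫⁻ n, F n ∂(φ.ker p) = F (r p)

theorem PreCell.IsDet.comp {φ : PreCell κ κ'} {ψ : PreCell κ' κ''} {r : A × M × B → N}
    {s : A × N × B → P} (hφ : φ.IsDet r) (hψ : ψ.IsDet s) :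
    (φ.comp ψ).IsDet (fun p => s (p.1, r p, p.2.2)) := by
  intro p F hF
  rw [PreCell.lintegral_comp_ker _ _ _ hF, hφ _ _ (by fun_prop), hψ _ _ hF]

theorem PreCell.isDet_det {r : A × M × B → N} {hr : Measurable r}
    {h : ∀ a, ∀ F : N × B → ℝ≥0∞, Measurable F →
      ∫⁻ t, F t ∂(κ' a) = ∫⁻ w, F (r (a, w), w.2) ∂(κ a)} :
    (PreCell.det κ κ' r hr h).IsDet r :=
  fun p _ hF => PreCell.lintegral_det_ker p hF

theorem PreCell.IsDet.seqLeft {φ : PreCell κ κ'} {r : A × M × B → N} (hφ : φ.IsDet r)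
    (θ : Kernel C (P × A)) [IsMarkovKernel θ] :
    (φ.seqLeft θ).IsDet (fun p => (p.2.1.1, r (p.2.1.1.2, p.2.1.2, p.2.2))) := by
  intro p F hF
  rw [PreCell.lintegral_seqLeft _ _ _ hF, hφ _ _ (by fun_prop)]

theorem PreCell.IsDet.seqRight {φ : PreCell κ κ'} {r : A × M × B → N} (hφ : φ.IsDet r)
    (θ : Kernel B (P × C)) [IsMarkovKernel θ] :
    (φ.seqRight θ).IsDet (fun p => ((r (p.1, p.2.1.1), p.2.1.1.2), p.2.1.2)) := by
  intro p F hF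
  rw [PreCell.lintegral_seqRight _ _ _ hF,
    hφ _ (fun n => F ((n, p.2.1.1.2), p.2.1.2)) (by fun_prop)]

theorem PreCell.IsDet.bseqLeft {φ : PreCell κ κ'} {r : A × M × B → N} (hφ : φ.IsDet r)
    (θ : Kernel B (P × C)) [IsMarkovKernel θ] :
    (φ.bseqLeft θ).IsDet (fun p => (p.2.1.1, r (p.1, p.2.1.2, p.2.1.1.2))) := by
  intro p F hF
  rw [PreCell.lintegral_bseqLeft _ _ _ hF, hφ _ _ (by fun_prop)]

theorem PreCell.IsDet.bseqRight {φ : PreCell κ κ'} {r : A × M × B → N} (hφ : φ.IsDet r)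
    {σ σ' : Kernel C (P × A)} [IsMarkovKernel σ] [IsMarkovKernel σ'] (e : σ = σ') :
    (φ.bseqRight e).IsDet
      (fun p => ((r (p.2.1.1.2, p.2.1.1.1, p.2.2), p.2.1.1.2), p.2.1.2)) := by
  intro p F hF
  rw [PreCell.lintegral_bseqRight _ _ _ hF,
    hφ _ (fun n => F ((n, p.2.1.1.2), p.2.1.2)) (by fun_prop)]

theorem PreCell.IsDet.eq {φ ψ : PreCell κ κ'} {r : A × M × B → N} (hφ : φ.IsDet r)
    (hψ : ψ.IsDet r) : (⟦φ⟧ : Cell κ κ') = ⟦ψ⟧ :=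
  Cell.mk_eq fun p F hF => (hφ p F hF).trans (hψ p F hF).symm

theorem PreCell.IsDet.equiv {φ ψ : PreCell κ κ'} {r s : A × M × B → N} (hφ : φ.IsDet r)
    (hψ : ψ.IsDet s) (hr : Measurable r) (hs : Measurable s)
    (H : ∀ a, ∀ F : (M × B) × N → ℝ≥0∞, Measurable F →
      ∫⁻ w, F (w, r (a, w)) ∂(κ a) = ∫⁻ w, F (w, s (a, w)) ∂(κ a)) : φ ≈ ψ := by
  refine PreCell.rel_iff.2 fun a F hF => ?_
  refine (lintegral_congr fun w => ?_).trans ((H a F hF).trans (lintegral_congr fun w => ?_))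
  · rw [hφ _ _ (by fun_prop)]
  · rw [hψ _ _ (by fun_prop)]

theorem lintegral_seq_triangle (κ : Kernel A (M × B)) [IsMarkovKernel κ] (η : Kernel B (N × C))
    [IsMarkovKernel η] (a : A)
    {F : (((((M × B) × PUnit.{u + 1}) × B) × N) × C) × ((M × B) × N) → ℝ≥0∞}
    (hF : Measurable F) :
    ∫⁻ w, F (w, (w.1.1.1.1, w.1.2)) ∂(seq (seq κ (idKer B)) η a) =
      ∫⁻ w, F (w, ((w.1.1.1.1.1, w.1.1.2), w.1.2)) ∂(seq (seq κ (idKer B)) η a) := by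
  rw [lintegral_seq (seq κ (idKer B)) _ _ (by fun_prop),
    lintegral_seq (seq κ (idKer B)) _ _ (by fun_prop),
    lintegral_seq_id_right _ _ (by fun_prop), lintegral_seq_id_right _ _ (by fun_prop)]

theorem lintegral_bseq_triangle (ρ : Kernel B (M × A)) [IsMarkovKernel ρ]
    (σ σ' : Kernel C (N × B)) [IsMarkovKernel σ] (e : σ' = σ) (c : C)
    {F : (((((M × B) × PUnit.{u + 1}) × B) × N) × A) × ((M × B) × N) → ℝ≥0∞}
    (hF : Measurable F) :
    ∫⁻ w, F (w, (w.1.1.1.1, w.1.2)) ∂(bseq (bseq ρ (idKer B)) σ' c) =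
      ∫⁻ w, F (w, ((w.1.1.1.1.1, w.1.1.2), w.1.2)) ∂(bseq (bseq ρ (idKer B)) σ' c) := by
  subst e
  rw [lintegral_bseq _ _ _ (by fun_prop), lintegral_bseq _ _ _ (by fun_prop)]
  refine lintegral_congr fun z => ?_
  rw [lintegral_bseq_id_right _ _ (by fun_prop), lintegral_bseq_id_right _ _ (by fun_prop)]

end Laws

end Cells

/-! ### Coparameterized channels and simple Bayesian lenses -/

/-- Coparameterized channels from `X` to `Y`: Markov kernels from `X` to `M × Y`. -/
structure Chan (X Y : MeasCat.{u}) where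
  M : MeasCat.{u}
  ker : Kernel X (M × Y)
  markov : IsMarkovKernel ker

attribute [instance] Chan.markov

/-- The predictive law on `Y` of a channel, for the prior `π`; the coparameter is discarded. -/
noncomputable def Chan.pred {X Y : MeasCat.{u}} (c : Chan X Y) (π : ProbabilityMeasure X) :
    ProbabilityMeasure Y :=
  ⟨((π : Measure X).bind c.ker).map Prod.snd, by
    have : IsProbabilityMeasure ((π : Measure X).bind c.ker) := inferInstance
    exact Measure.isProbabilityMeasure_map (by fun_prop)⟩

/-- Simple Bayesian lenses from `X` to `Y`: a forward channel together with a state-dependent backward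
channel from `Y` to `X` with the same coparameter. -/
structure Lens (X Y : MeasCat.{u}) where
  fwd : Chan X Y
  bwd : ProbabilityMeasure X → Kernel Y (fwd.M × X)
  markov : ∀ π, IsMarkovKernel (bwd π)

attribute [instance] Lens.markov

theorem Chan.lintegral_pred {X Y : MeasCat.{u}} (c : Chan X Y) (π : ProbabilityMeasure X)
    {F : Y → ℝ≥0∞} (hF : Measurable F) :
    ∫⁻ y, F y ∂(c.pred π : Measure Y) = ∫⁻ x, ∫⁻ w, F w.2 ∂(c.ker x) ∂(π : Measure X) := by
  change ∫⁻ y, F y ∂(((π : Measure X).bind c.ker).map Prod.snd) = _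
  rw [lintegral_map hF measurable_snd, Measure.lintegral_bind (by fun_prop) (by fun_prop)]

/-- The identity channel. -/
noncomputable def Chan.id (X : MeasCat.{u}) : Chan X X where
  M := MeasCat.of PUnit
  ker := idKer X
  markov := inferInstanceAs (IsMarkovKernel (idKer X))

/-- Copy-composition of channels. -/
noncomputable def Chan.comp {X Y Z : MeasCat.{u}} (c : Chan X Y) (d : Chan Y Z) : Chan X Z where
  M := MeasCat.of ((c.M × Y) × d.M)
  ker := seq c.ker d.ker
  markov := inferInstance

/-- The identity lens. -/
noncomputable def Lens.id (X : MeasCat.{u}) : Lens X X where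
  fwd := Chan.id X
  bwd _ := idKer X
  markov _ := inferInstanceAs (IsMarkovKernel (idKer X))

/-- Composition of lenses: the backward channel of `g` is taken at the predictive law of `f`. -/
noncomputable def Lens.comp {X Y Z : MeasCat.{u}} (f : Lens X Y) (g : Lens Y Z) : Lens X Z where
  fwd := f.fwd.comp g.fwd
  bwd π := bseq (f.bwd π) (g.bwd (f.fwd.pred π))
  markov π := inferInstanceAs (IsMarkovKernel (bseq (f.bwd π) (g.bwd (f.fwd.pred π))))


theorem Chan.pred_eq {X Y : MeasCat.{u}} {c d : Chan X Y} (φ : Cell c.ker d.ker)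
    (π : ProbabilityMeasure X) : c.pred π = d.pred π := by
  induction φ using Quotient.ind with
  | _ φ =>
    refine Subtype.ext (Measure.ext_of_lintegral _ fun F hF => ?_)
    have h1 := c.lintegral_pred π hF
    have h2 := d.lintegral_pred π hF
    refine h1.trans (Eq.trans ?_ h2.symm)
    refine lintegral_congr fun x => ?_
    rw [φ.lintegral_tgt _ (by fun_prop)]
    simp

@[simp]
theorem Chan.pred_id {X : MeasCat.{u}} (π : ProbabilityMeasure X) : (Chan.id X).pred π = π := by
  refine Subtype.ext (Measure.ext_of_lintegral _ fun F hF => ?_)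
  refine ((Chan.id X).lintegral_pred π hF).trans (lintegral_congr fun x => ?_)
  exact lintegral_idKer x (F := fun w => F w.2) (by fun_prop)

@[simp]
theorem Chan.pred_comp {X Y Z : MeasCat.{u}} (c : Chan X Y) (d : Chan Y Z)
    (π : ProbabilityMeasure X) : (c.comp d).pred π = d.pred (c.pred π) := by
  refine Subtype.ext (Measure.ext_of_lintegral _ fun F hF => ?_)
  have h1 := (c.comp d).lintegral_pred π hF
  have h2 := d.lintegral_pred (c.pred π) hF
  have h3 := c.lintegral_pred π (F := fun y => ∫⁻ w, F w.2 ∂(d.ker y)) (by fun_prop)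
  refine h1.trans (Eq.trans ?_ (h2.trans h3).symm)
  refine lintegral_congr fun x => ?_
  exact lintegral_seq c.ker d.ker x (F := fun w => F w.2) (by fun_prop)

/-- 2-cells of lenses: a 2-cell of forward channels and, for each state, a 2-cell of backward
channels. -/
@[ext]
structure Lens.Hom {X Y : MeasCat.{u}} (f g : Lens X Y) where
  fwd : Cell f.fwd.ker g.fwd.ker
  bwd : ∀ π, Cell (f.bwd π) (g.bwd π)

/-- The 2-cell of lenses given by a pair of functions. -/
noncomputable def Lens.det {X Y : MeasCat.{u}} (f g : Lens X Y)
    (r : X × f.fwd.M × Y → g.fwd.M) (hr : Measurable r)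
    (r' : Y × f.fwd.M × X → g.fwd.M) (hr' : Measurable r')
    (h : ∀ x, ∀ F : g.fwd.M × Y → ℝ≥0∞, Measurable F →
      ∫⁻ t, F t ∂(g.fwd.ker x) = ∫⁻ w, F (r (x, w), w.2) ∂(f.fwd.ker x))
    (h' : ∀ π, ∀ y, ∀ F : g.fwd.M × X → ℝ≥0∞, Measurable F →
      ∫⁻ t, F t ∂(g.bwd π y) = ∫⁻ w, F (r' (y, w), w.2) ∂(f.bwd π y)) : Lens.Hom f g where
  fwd := ⟦PreCell.det _ _ r hr h⟧
  bwd π := ⟦PreCell.det _ _ r' hr' (h' π)⟧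

noncomputable instance (X Y : MeasCat.{u}) : Category (Lens X Y) where
  Hom := Lens.Hom
  id f := ⟨Cell.id _, fun _ => Cell.id _⟩
  comp η θ := ⟨η.fwd.comp θ.fwd, fun π => (η.bwd π).comp (θ.bwd π)⟩
  id_comp := by
    have key : ∀ {A B M N : Type u} [MeasurableSpace A] [MeasurableSpace B] [MeasurableSpace M]
        [MeasurableSpace N] (κ : Kernel A (M × B)) [IsMarkovKernel κ] (κ' : Kernel A (N × B))
        [IsMarkovKernel κ'] (φ : Cell κ κ'), (Cell.id κ).comp φ = φ := by
      intro A B M N _ _ _ _ κ _ κ' _ φ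
      induction φ using Quotient.ind with
      | _ φ =>
      refine Cell.mk_eq fun p F hF => ?_
      refine (lintegral_vcomp _ _ p.1 p.2 hF).trans ?_
      exact lintegral_det _ (by fun_prop) _ (by fun_prop)
    intro f g η
    exact Lens.Hom.ext (key _ _ _) (funext fun π => key _ _ _)
  comp_id := by
    have key : ∀ {A B M N : Type u} [MeasurableSpace A] [MeasurableSpace B] [MeasurableSpace M]
        [MeasurableSpace N] (κ : Kernel A (M × B)) [IsMarkovKernel κ] (κ' : Kernel A (N × B))
        [IsMarkovKernel κ'] (φ : Cell κ κ'), φ.comp (Cell.id κ') = φ := by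
      intro A B M N _ _ _ _ κ _ κ' _ φ
      induction φ using Quotient.ind with
      | _ φ =>
      refine Cell.mk_eq fun p F hF => ?_
      refine (lintegral_vcomp _ _ p.1 p.2 hF).trans (lintegral_congr fun n => ?_)
      exact lintegral_det _ (by fun_prop) _ (by fun_prop)
    intro f g η
    exact Lens.Hom.ext (key _ _ _) (funext fun π => key _ _ _)
  assoc := by
    have key : ∀ {A B M N P Q : Type u} [MeasurableSpace A] [MeasurableSpace B]
        [MeasurableSpace M] [MeasurableSpace N] [MeasurableSpace P] [MeasurableSpace Q]
        (κ : Kernel A (M × B)) [IsMarkovKernel κ] (κ' : Kernel A (N × B)) [IsMarkovKernel κ']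
        (κ'' : Kernel A (P × B)) [IsMarkovKernel κ''] (κ₃ : Kernel A (Q × B))
        (φ : Cell κ κ') (ψ : Cell κ' κ'') (χ : Cell κ'' κ₃),
        (φ.comp ψ).comp χ = φ.comp (ψ.comp χ) := by
      intro A B M N P Q _ _ _ _ _ _ κ _ κ' _ κ'' _ κ₃ φ ψ χ
      induction φ using Quotient.ind with
      | _ φ =>
      induction ψ using Quotient.ind with
      | _ ψ =>
      induction χ using Quotient.ind with
      | _ χ =>
      refine Cell.mk_eq fun p F hF => ?_
      obtain ⟨a, w⟩ := p
      refine (lintegral_vcomp _ _ a w hF).trans (Eq.trans ?_ (lintegral_vcomp _ _ a w hF).symm)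
      refine (lintegral_vcomp _ _ a w (by fun_prop)).trans (lintegral_congr fun n => ?_)
      exact (lintegral_vcomp _ _ a _ hF).symm
    intro f g h k η θ ζ
    exact Lens.Hom.ext (key _ _ _ _ _ _ _) (funext fun π => key _ _ _ _ _ _ _)

/-- The 0-cells of the bicategory of simple Bayesian lenses. -/
structure BLens : Type (u + 1) where
  space : MeasCat.{u}

noncomputable instance : CategoryStruct BLens.{u} where
  Hom X Y := Lens X.space Y.space
  id X := Lens.id X.space
  comp f g := Lens.comp f g


theorem Lens.bwd_pred_eq {X Y Z : MeasCat.{u}} {f g : Lens X Y} (η : f ⟶ g) (h : Lens Y Z)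
    (π : ProbabilityMeasure X) : h.bwd (f.fwd.pred π) = h.bwd (g.fwd.pred π) := by
  rw [Chan.pred_eq η.fwd π]

/-- Left whiskering. -/
noncomputable def Lens.whiskerLeft {X Y Z : MeasCat.{u}} (f : Lens X Y) {g h : Lens Y Z}
    (η : g ⟶ h) : f.comp g ⟶ f.comp h :=
  Lens.Hom.mk (f := f.comp g) (g := f.comp h) (Cell.seqLeft f.fwd.ker η.fwd)
    fun π => Cell.bseqLeft (f.bwd π) (η.bwd (f.fwd.pred π))

/-- Right whiskering. -/
noncomputable def Lens.whiskerRight {X Y Z : MeasCat.{u}} {f g : Lens X Y} (η : f ⟶ g)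
    (h : Lens Y Z) : f.comp h ⟶ g.comp h :=
  Lens.Hom.mk (f := f.comp h) (g := g.comp h) (Cell.seqRight h.fwd.ker η.fwd)
    fun π => Cell.bseqRight (Lens.bwd_pred_eq η h π) (η.bwd π)

noncomputable def Lens.assocHom {W X Y Z : MeasCat.{u}} (f : Lens W X) (g : Lens X Y)
    (h : Lens Y Z) : (f.comp g).comp h ⟶ f.comp (g.comp h) :=
  Lens.det ((f.comp g).comp h) (f.comp (g.comp h))
    (fun p => (p.2.1.1.1.1, ((p.2.1.1.1.2, p.2.1.1.2), p.2.1.2)))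
    (by
      change Measurable (fun p : W × ((((f.fwd.M × X) × g.fwd.M) × Y) × h.fwd.M) × Z => _)
      fun_prop)
    (fun p => (p.2.1.1.1.1, ((p.2.1.1.1.2, p.2.1.1.2), p.2.1.2)))
    (by
      change Measurable (fun p : Z × ((((f.fwd.M × X) × g.fwd.M) × Y) × h.fwd.M) × W => _)
      fun_prop)
    (by
      intro x F hF
      exact lintegral_seq_assoc f.fwd.ker g.fwd.ker h.fwd.ker x hF)
    (by
      intro π y F hF
      have e : ((f.comp g).comp h).bwd π = bseq (bseq (f.bwd π) (g.bwd (f.fwd.pred π)))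
          (h.bwd (g.fwd.pred (f.fwd.pred π))) := by
        rw [← Chan.pred_comp]; rfl
      rw [e]
      exact lintegral_bseq_assoc (f.bwd π) (g.bwd (f.fwd.pred π))
        (h.bwd (g.fwd.pred (f.fwd.pred π))) y hF)

noncomputable def Lens.assocInv {W X Y Z : MeasCat.{u}} (f : Lens W X) (g : Lens X Y)
    (h : Lens Y Z) : f.comp (g.comp h) ⟶ (f.comp g).comp h :=
  Lens.det (f.comp (g.comp h)) ((f.comp g).comp h)
    (fun p => (((p.2.1.1, p.2.1.2.1.1), p.2.1.2.1.2), p.2.1.2.2))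
    (by
      change Measurable
        (fun p : W × ((f.fwd.M × X) × ((g.fwd.M × Y) × h.fwd.M)) × Z => _)
      fun_prop)
    (fun p => (((p.2.1.1, p.2.1.2.1.1), p.2.1.2.1.2), p.2.1.2.2))
    (by
      change Measurable
        (fun p : Z × ((f.fwd.M × X) × ((g.fwd.M × Y) × h.fwd.M)) × W => _)
      fun_prop)
    (by
      intro x F hF
      exact lintegral_seq_assoc' f.fwd.ker g.fwd.ker h.fwd.ker x hF)
    (by
      intro π y F hF
      have e : ((f.comp g).comp h).bwd π = bseq (bseq (f.bwd π) (g.bwd (f.fwd.pred π)))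
          (h.bwd (g.fwd.pred (f.fwd.pred π))) := by
        rw [← Chan.pred_comp]; rfl
      rw [e]
      exact lintegral_bseq_assoc' (f.bwd π) (g.bwd (f.fwd.pred π))
        (h.bwd (g.fwd.pred (f.fwd.pred π))) y hF)


noncomputable def Lens.leftUnitorHom {X Y : MeasCat.{u}} (f : Lens X Y) :
    (Lens.id X).comp f ⟶ f :=
  Lens.det ((Lens.id X).comp f) f (fun p => p.2.1.2)
    (by
      change Measurable (fun p : X × ((PUnit.{u + 1} × X) × f.fwd.M) × Y => _)
      fun_prop)
    (fun p => p.2.1.2)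
    (by
      change Measurable (fun p : Y × ((PUnit.{u + 1} × X) × f.fwd.M) × X => _)
      fun_prop)
    (fun x F hF => (lintegral_seq_id_left f.fwd.ker x (F := fun t => F (t.1.2, t.2))
      (by fun_prop)).symm)
    (by
      intro π y F hF
      have e : ((Lens.id X).comp f).bwd π = bseq (idKer X) (f.bwd π) := by
        conv_rhs => rw [← Chan.pred_id π]
        rfl
      rw [e]
      exact (lintegral_bseq_id_left (f.bwd π) y (F := fun t => F (t.1.2, t.2))
        (by fun_prop)).symm)

noncomputable def Lens.leftUnitorInv {X Y : MeasCat.{u}} (f : Lens X Y) :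
    f ⟶ (Lens.id X).comp f :=
  Lens.det f ((Lens.id X).comp f) (fun p => ((PUnit.unit, p.1), p.2.1))
    (by
      change Measurable (fun p : X × f.fwd.M × Y => ((PUnit.unit.{u + 1}, p.1), p.2.1))
      fun_prop)
    (fun p => ((PUnit.unit, p.2.2), p.2.1))
    (by
      change Measurable (fun p : Y × f.fwd.M × X => ((PUnit.unit.{u + 1}, p.2.2), p.2.1))
      fun_prop)
    (fun x F hF => lintegral_seq_id_left f.fwd.ker x hF)
    (by
      intro π y F hF
      have e : ((Lens.id X).comp f).bwd π = bseq (idKer X) (f.bwd π) := by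
        conv_rhs => rw [← Chan.pred_id π]
        rfl
      rw [e]
      exact lintegral_bseq_id_left (f.bwd π) y hF)

noncomputable def Lens.rightUnitorHom {X Y : MeasCat.{u}} (f : Lens X Y) :
    f.comp (Lens.id Y) ⟶ f :=
  Lens.det (f.comp (Lens.id Y)) f (fun p => p.2.1.1.1)
    (by
      change Measurable (fun p : X × ((f.fwd.M × Y) × PUnit.{u + 1}) × Y => _)
      fun_prop)
    (fun p => p.2.1.1.1)
    (by
      change Measurable (fun p : Y × ((f.fwd.M × Y) × PUnit.{u + 1}) × X => _)
      fun_prop)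
    (fun x F hF => (lintegral_seq_id_right f.fwd.ker x (F := fun t => F (t.1.1.1, t.2))
      (by fun_prop)).symm)
    (fun π y F hF => (lintegral_bseq_id_right (f.bwd π) y (F := fun t => F (t.1.1.1, t.2))
      (by fun_prop)).symm)

noncomputable def Lens.rightUnitorInv {X Y : MeasCat.{u}} (f : Lens X Y) :
    f ⟶ f.comp (Lens.id Y) :=
  Lens.det f (f.comp (Lens.id Y)) (fun p => ((p.2.1, p.2.2), PUnit.unit))
    (by
      change Measurable (fun p : X × f.fwd.M × Y => ((p.2.1, p.2.2), PUnit.unit.{u + 1}))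
      fun_prop)
    (fun p => ((p.2.1, p.1), PUnit.unit))
    (by
      change Measurable (fun p : Y × f.fwd.M × X => ((p.2.1, p.1), PUnit.unit.{u + 1}))
      fun_prop)
    (fun x F hF => lintegral_seq_id_right f.fwd.ker x hF)
    (fun π y F hF => lintegral_bseq_id_right (f.bwd π) y hF)


noncomputable def Lens.associator {W X Y Z : MeasCat.{u}} (f : Lens W X) (g : Lens X Y)
    (h : Lens Y Z) : (f.comp g).comp h ≅ f.comp (g.comp h) where
  hom := Lens.assocHom f g h
  inv := Lens.assocInv f g h
  hom_inv_id := Lens.Hom.ext (Cell.det_comp_det fun _ _ _ => rfl)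
    (funext fun _ => Cell.det_comp_det fun _ _ _ => rfl)
  inv_hom_id := Lens.Hom.ext (Cell.det_comp_det fun _ _ _ => rfl)
    (funext fun _ => Cell.det_comp_det fun _ _ _ => rfl)

noncomputable def Lens.leftUnitor {X Y : MeasCat.{u}} (f : Lens X Y) :
    (Lens.id X).comp f ≅ f where
  hom := Lens.leftUnitorHom f
  inv := Lens.leftUnitorInv f
  hom_inv_id := by
    refine Lens.Hom.ext (Cell.det_comp_det fun x F hF => ?_)
      (funext fun π => Cell.det_comp_det fun y F hF => ?_)
    · refine (lintegral_seq_id_left f.fwd.ker x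
        (F := fun w => F (w, ((PUnit.unit, x), w.1.2))) ?_).trans
        (lintegral_seq_id_left f.fwd.ker x (F := fun w => F (w, w.1)) ?_).symm
      · exact hF.comp (by fun_prop)
      · exact hF.comp (by fun_prop)
    · have e : ((Lens.id X).comp f).bwd π = bseq (idKer X) (f.bwd π) := by
        conv_rhs => rw [← Chan.pred_id π]
        rfl
      rw [e]
      refine (lintegral_bseq_id_left (f.bwd π) y
        (F := fun w => F (w, ((PUnit.unit, w.2), w.1.2))) ?_).trans
        (lintegral_bseq_id_left (f.bwd π) y (F := fun w => F (w, w.1)) ?_).symm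
      · exact hF.comp (by fun_prop)
      · exact hF.comp (by fun_prop)
  inv_hom_id := Lens.Hom.ext (Cell.det_comp_det fun _ _ _ => rfl)
    (funext fun _ => Cell.det_comp_det fun _ _ _ => rfl)

noncomputable def Lens.rightUnitor {X Y : MeasCat.{u}} (f : Lens X Y) :
    f.comp (Lens.id Y) ≅ f where
  hom := Lens.rightUnitorHom f
  inv := Lens.rightUnitorInv f
  hom_inv_id := by
    refine Lens.Hom.ext (Cell.det_comp_det fun x F hF => ?_)
      (funext fun π => Cell.det_comp_det fun y F hF => ?_)
    · refine (lintegral_seq_id_right f.fwd.ker x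
        (F := fun w => F (w, ((w.1.1.1, w.2), PUnit.unit))) ?_).trans
        (lintegral_seq_id_right f.fwd.ker x (F := fun w => F (w, w.1)) ?_).symm
      · exact hF.comp (by fun_prop)
      · exact hF.comp (by fun_prop)
    · refine (lintegral_bseq_id_right (f.bwd π) y
        (F := fun w => F (w, ((w.1.1.1, y), PUnit.unit))) ?_).trans
        (lintegral_bseq_id_right (f.bwd π) y (F := fun w => F (w, w.1)) ?_).symm
      · exact hF.comp (by fun_prop)
      · exact hF.comp (by fun_prop)
  inv_hom_id := Lens.Hom.ext (Cell.det_comp_det fun _ _ _ => rfl)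
    (funext fun _ => Cell.det_comp_det fun _ _ _ => rfl)


theorem Lens.Hom.exists_rep {X Y : MeasCat.{u}} {f g : Lens X Y} (η : Lens.Hom f g) :
    ∃ (φ : PreCell f.fwd.ker g.fwd.ker) (ψ : ∀ π, PreCell (f.bwd π) (g.bwd π)),
      η = ⟨⟦φ⟧, fun π => ⟦ψ π⟧⟩ := by
  obtain ⟨φ, hφ⟩ := Quotient.exists_rep η.fwd
  choose ψ hψ using fun π => Quotient.exists_rep (η.bwd π)
  exact ⟨φ, ψ, Lens.Hom.ext hφ.symm (funext fun π => (hψ π).symm)⟩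

/-- The bicategory of simple coparameterized Bayesian lenses. -/
noncomputable instance : Bicategory BLens.{u} where
  homCategory X Y := inferInstanceAs (Category (Lens X.space Y.space))
  whiskerLeft f _ _ η := Lens.whiskerLeft f η
  whiskerRight η h := Lens.whiskerRight η h
  associator f g h := Lens.associator f g h
  leftUnitor f := Lens.leftUnitor f
  rightUnitor f := Lens.rightUnitor f
  whiskerLeft_id f g := Lens.Hom.ext (Cell.mk_eq fun p F hF => seqLeft_id p F hF)
    (funext fun π => Cell.mk_eq fun p F hF => bseqLeft_id p (f.bwd π) F hF)
  whiskerLeft_comp f g h i η θ := by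
    obtain ⟨φ, φ', rfl⟩ := η.exists_rep
    obtain ⟨ψ, ψ', rfl⟩ := θ.exists_rep
    exact Lens.Hom.ext (Cell.mk_eq fun p F hF => seqLeft_comp φ ψ f.fwd.ker p F hF)
      (funext fun π => Cell.mk_eq fun p F hF =>
        bseqLeft_comp (φ' (f.fwd.pred π)) (ψ' (f.fwd.pred π)) (f.bwd π) p F hF)
  id_whiskerLeft η := by
    obtain ⟨φ, φ', rfl⟩ := η.exists_rep
    refine Lens.Hom.ext (Quotient.sound (id_seqLeft φ)) (funext fun π => ?_)
    exact Quotient.sound (id_bseqLeft (φ' π) (φ' ((Chan.id _).pred π))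
      (congrArg _ (Chan.pred_id π)) (congrArg _ (Chan.pred_id π))
      (congrArg (fun q => (φ' q).ker) (Chan.pred_id π)))
  comp_whiskerLeft f g _ _ η := by
    obtain ⟨φ, φ', rfl⟩ := η.exists_rep
    refine Lens.Hom.ext (Cell.mk_eq fun p F hF => ?_) (funext fun π => Cell.mk_eq fun p F hF => ?_)
    · refine Eq.trans ?_ (PreCell.lintegral_conj _ p hF).symm
      exact seqLeft_seq φ f.fwd.ker g.fwd.ker p F hF
    · refine Eq.trans ?_ (PreCell.lintegral_conj _ p hF).symm
      exact bseqLeft_bseq (φ' _) (φ' (g.fwd.pred (f.fwd.pred π)))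
        (congrArg (fun q => (φ' q).ker) (Chan.pred_comp f.fwd g.fwd π)) (f.bwd π)
        (g.bwd (f.fwd.pred π)) p F hF
  id_whiskerRight f g := Lens.Hom.ext (Cell.mk_eq fun p F hF => seqRight_id p F hF)
    (funext fun π => Cell.mk_eq fun p F hF => bseqRight_id p (f.bwd π) F hF)
  comp_whiskerRight η θ i := by
    have e1 := Lens.bwd_pred_eq η i
    have e2 := Lens.bwd_pred_eq θ i
    obtain ⟨φ, φ', rfl⟩ := η.exists_rep
    obtain ⟨ψ, ψ', rfl⟩ := θ.exists_rep
    exact Lens.Hom.ext (Cell.mk_eq fun p F hF => seqRight_comp φ ψ i.fwd.ker p F hF)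
      (funext fun π => Cell.mk_eq fun p F hF =>
        bseqRight_comp (φ' π) (ψ' π) (e1 π) (e2 π) ((e1 π).trans (e2 π)) p F hF)
  whiskerRight_id η := by
    have e1 := Lens.bwd_pred_eq η (Lens.id _)
    obtain ⟨φ, φ', rfl⟩ := η.exists_rep
    refine Lens.Hom.ext (Quotient.sound (seqRight_idKer φ)) (funext fun π => ?_)
    exact Quotient.sound (bseqRight_idKer (φ' π) (e1 π))
  whiskerRight_comp η g h := by
    have e1 := Lens.bwd_pred_eq η g
    have e2 := Lens.bwd_pred_eq (Lens.whiskerRight η g) h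
    have e3 := Lens.bwd_pred_eq η (g.comp h)
    have hm : ∀ π, IsMarkovKernel ((Lens.comp g h).bwd π) := (Lens.comp g h).markov
    obtain ⟨φ, φ', rfl⟩ := η.exists_rep
    refine Lens.Hom.ext (Cell.mk_eq fun p F hF => ?_) (funext fun π => Cell.mk_eq fun p F hF => ?_)
    · refine Eq.trans ?_ (PreCell.lintegral_conj _ p hF).symm
      exact seqRight_seq φ g.fwd.ker h.fwd.ker p F hF
    · refine Eq.trans ?_ (PreCell.lintegral_conj _ p hF).symm
      exact bseqRight_bseq (φ' π) (hm _) (e1 π) (e2 π) (e3 π) p F hF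
  whisker_assoc f _ _ η h := by
    have e1 := Lens.bwd_pred_eq (Lens.whiskerLeft f η) h
    have e2 := fun π => Lens.bwd_pred_eq η h (f.fwd.pred π)
    obtain ⟨φ, φ', rfl⟩ := η.exists_rep
    refine Lens.Hom.ext (Cell.mk_eq fun p F hF => ?_) (funext fun π => Cell.mk_eq fun p F hF => ?_)
    · refine Eq.trans ?_ (PreCell.lintegral_conj _ p hF).symm
      exact seqMiddle φ f.fwd.ker h.fwd.ker p F hF
    · refine Eq.trans ?_ (PreCell.lintegral_conj _ p hF).symm
      exact bseqMiddle (φ' (f.fwd.pred π)) (f.bwd π) (e1 π) (e2 π) p F hF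
  whisker_exchange {_ _ _ f g h i} η θ := by
    have e1 := Lens.bwd_pred_eq η h
    have e2 := Lens.bwd_pred_eq η i
    have e3 := fun π => Chan.pred_eq η.fwd π
    obtain ⟨φ, φ', rfl⟩ := η.exists_rep
    obtain ⟨ψ, ψ', rfl⟩ := θ.exists_rep
    exact Lens.Hom.ext (Cell.mk_eq fun p F hF => exchange_seq φ ψ p F hF)
      (funext fun π => Cell.mk_eq fun p F hF => exchange_bseq (φ' π) (ψ' _) (ψ' _) (e1 π) (e2 π)
        (congrArg (fun q => (ψ' q).ker) (e3 π)) p F hF)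
  pentagon f g h i := Lens.Hom.ext
    (PreCell.IsDet.eq
      ((PreCell.isDet_det.seqRight i.fwd.ker).comp
        (PreCell.isDet_det.comp (PreCell.isDet_det.seqLeft f.fwd.ker)))
      (PreCell.isDet_det.comp PreCell.isDet_det))
    (funext fun π => PreCell.IsDet.eq
      ((PreCell.isDet_det.bseqRight _).comp
        (PreCell.isDet_det.comp (PreCell.isDet_det.bseqLeft (f.bwd π))))
      (PreCell.isDet_det.comp PreCell.isDet_det))
  triangle {a b c} f g := by
    have hf : ∀ π, IsMarkovKernel (f.bwd π) := f.markov
    refine Lens.Hom.ext (Quotient.sound ?_) (funext fun π => Quotient.sound ?_)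
    · refine PreCell.IsDet.equiv
        (PreCell.isDet_det.comp (PreCell.isDet_det.seqLeft f.fwd.ker))
        (PreCell.isDet_det.seqRight g.fwd.ker) ?_ ?_
        fun x F hF => lintegral_seq_triangle f.fwd.ker g.fwd.ker x hF
      · change Measurable (fun p : a.space × (((((f.fwd.M × b.space) × PUnit.{u + 1}) × b.space) ×
          g.fwd.M) × c.space) => (p.2.1.1.1.1, p.2.1.2))
        fun_prop
      · change Measurable (fun p : a.space × (((((f.fwd.M × b.space) × PUnit.{u + 1}) × b.space) ×
          g.fwd.M) × c.space) => ((p.2.1.1.1.1.1, p.2.1.1.2), p.2.1.2))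
        fun_prop
    · refine PreCell.IsDet.equiv
        (PreCell.isDet_det.comp (PreCell.isDet_det.bseqLeft (f.bwd π)))
        (PreCell.isDet_det.bseqRight (Lens.bwd_pred_eq (Lens.rightUnitorHom f) g π)) ?_ ?_
        fun z F hF => lintegral_bseq_triangle (f.bwd π) (g.bwd (f.fwd.pred π)) _
          (Lens.bwd_pred_eq (Lens.rightUnitorHom f) g π) z hF
      · change Measurable (fun p : c.space × (((((f.fwd.M × b.space) × PUnit.{u + 1}) × b.space) ×
          g.fwd.M) × a.space) => (p.2.1.1.1.1, p.2.1.2))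
        fun_prop
      · change Measurable (fun p : c.space × (((((f.fwd.M × b.space) × PUnit.{u + 1}) × b.space) ×
          g.fwd.M) × a.space) => ((p.2.1.1.1.1.1, p.2.1.1.2), p.2.1.2))
        fun_prop

end StatGames

/-! ### Sub-bicategories with only structural 2-cells -/

namespace StatGames

section Sub

open Bicategory

universe w₁ v₁ u₁

variable {𝓑 : Type u₁} [Bicategory.{w₁, v₁} 𝓑]

/-- A class of 0-cells and a class of 1-cells between them, closed under identities and
composition. -/
structure SubBicat (𝓑 : Type u₁) [Bicategory.{w₁, v₁} 𝓑] where
  obj : Set 𝓑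
  hom : ∀ X Y : 𝓑, Set (X ⟶ Y)
  id_mem : ∀ ⦃X⦄, X ∈ obj → 𝟙 X ∈ hom X X
  comp_mem : ∀ ⦃X Y Z⦄, X ∈ obj → Y ∈ obj → Z ∈ obj → ∀ {f : X ⟶ Y} {g : Y ⟶ Z},
    f ∈ hom X Y → g ∈ hom Y Z → f ≫ g ∈ hom X Z

namespace SubBicat

variable (B : SubBicat 𝓑)

/-- 0-cells of `B`. -/
structure Obj where
  val : 𝓑
  mem : val ∈ B.obj

variable {B}

/-- 1-cells of `B`. -/
@[ext]
structure Hom (X Y : B.Obj) where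
  val : X.val ⟶ Y.val
  mem : val ∈ B.hom X.val Y.val

instance : CategoryStruct B.Obj where
  Hom := Hom
  id X := ⟨𝟙 X.val, B.id_mem X.mem⟩
  comp {X Y Z} f g := ⟨f.val ≫ g.val, B.comp_mem X.mem Y.mem Z.mem f.mem g.mem⟩

/-- The structural 2-cells between 1-cells of `B`: those generated under vertical composition and
whiskering by the identities, the associators, the unitors and their inverses. -/
inductive Structural : ∀ {X Y : B.Obj} (f g : X ⟶ Y), (f.val ⟶ g.val) → Prop
  | id {X Y : B.Obj} (f : X ⟶ Y) : Structural f f (𝟙 f.val)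
  | comp {X Y : B.Obj} {f g h : X ⟶ Y} {η : f.val ⟶ g.val} {θ : g.val ⟶ h.val} :
      Structural f g η → Structural g h θ → Structural f h (η ≫ θ)
  | whiskerLeft {X Y Z : B.Obj} (f : X ⟶ Y) {g h : Y ⟶ Z} {η : g.val ⟶ h.val} :
      Structural g h η → Structural (f ≫ g) (f ≫ h) (f.val ◁ η)
  | whiskerRight {X Y Z : B.Obj} {f g : X ⟶ Y} {η : f.val ⟶ g.val} (h : Y ⟶ Z) :
      Structural f g η → Structural (f ≫ h) (g ≫ h) (η ▷ h.val)
  | associator {W X Y Z : B.Obj} (f : W ⟶ X) (g : X ⟶ Y) (h : Y ⟶ Z) :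
      Structural ((f ≫ g) ≫ h) (f ≫ g ≫ h) (α_ f.val g.val h.val).hom
  | associatorInv {W X Y Z : B.Obj} (f : W ⟶ X) (g : X ⟶ Y) (h : Y ⟶ Z) :
      Structural (f ≫ g ≫ h) ((f ≫ g) ≫ h) (α_ f.val g.val h.val).inv
  | leftUnitor {X Y : B.Obj} (f : X ⟶ Y) : Structural (𝟙 X ≫ f) f (λ_ f.val).hom
  | leftUnitorInv {X Y : B.Obj} (f : X ⟶ Y) : Structural f (𝟙 X ≫ f) (λ_ f.val).inv
  | rightUnitor {X Y : B.Obj} (f : X ⟶ Y) : Structural (f ≫ 𝟙 Y) f (ρ_ f.val).hom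
  | rightUnitorInv {X Y : B.Obj} (f : X ⟶ Y) : Structural f (f ≫ 𝟙 Y) (ρ_ f.val).inv

/-- 2-cells of `B`. -/
@[ext]
structure Hom₂ {X Y : B.Obj} (f g : X ⟶ Y) where
  val : f.val ⟶ g.val
  structural : Structural f g val

instance homCategory (X Y : B.Obj) : Category (X ⟶ Y) where
  Hom := Hom₂
  id f := ⟨𝟙 f.val, .id f⟩
  comp η θ := ⟨η.val ≫ θ.val, .comp η.structural θ.structural⟩
  id_comp η := Hom₂.ext (Category.id_comp η.val)
  comp_id η := Hom₂.ext (Category.comp_id η.val)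
  assoc η θ ζ := Hom₂.ext (Category.assoc η.val θ.val ζ.val)

theorem hom₂_ext {X Y : B.Obj} {f g : X ⟶ Y} {η θ : f ⟶ g} (h : η.val = θ.val) : η = θ :=
  Hom₂.ext h

instance : Bicategory B.Obj where
  homCategory := homCategory
  whiskerLeft f _ _ η := ⟨f.val ◁ η.val, .whiskerLeft f η.structural⟩
  whiskerRight η h := ⟨η.val ▷ h.val, .whiskerRight h η.structural⟩
  associator f g h :=
    ⟨⟨(α_ f.val g.val h.val).hom, .associator f g h⟩,
      ⟨(α_ f.val g.val h.val).inv, .associatorInv f g h⟩,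
      hom₂_ext (α_ f.val g.val h.val).hom_inv_id, hom₂_ext (α_ f.val g.val h.val).inv_hom_id⟩
  leftUnitor f :=
    ⟨⟨(λ_ f.val).hom, .leftUnitor f⟩, ⟨(λ_ f.val).inv, .leftUnitorInv f⟩,
      hom₂_ext (λ_ f.val).hom_inv_id, hom₂_ext (λ_ f.val).inv_hom_id⟩
  rightUnitor f :=
    ⟨⟨(ρ_ f.val).hom, .rightUnitor f⟩, ⟨(ρ_ f.val).inv, .rightUnitorInv f⟩,
      hom₂_ext (ρ_ f.val).hom_inv_id, hom₂_ext (ρ_ f.val).inv_hom_id⟩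
  whiskerLeft_id f g := hom₂_ext (Bicategory.whiskerLeft_id f.val g.val)
  whiskerLeft_comp f _ _ _ η θ := hom₂_ext (Bicategory.whiskerLeft_comp f.val η.val θ.val)
  id_whiskerLeft η := hom₂_ext (Bicategory.id_whiskerLeft η.val)
  comp_whiskerLeft f g _ _ η := hom₂_ext (Bicategory.comp_whiskerLeft f.val g.val η.val)
  id_whiskerRight f g := hom₂_ext (Bicategory.id_whiskerRight f.val g.val)
  comp_whiskerRight η θ i := hom₂_ext (Bicategory.comp_whiskerRight η.val θ.val i.val)
  whiskerRight_id η := hom₂_ext (Bicategory.whiskerRight_id η.val)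
  whiskerRight_comp η g h := hom₂_ext (Bicategory.whiskerRight_comp η.val g.val h.val)
  whisker_assoc f _ _ η h := hom₂_ext (Bicategory.whisker_assoc f.val η.val h.val)
  whisker_exchange η θ := hom₂_ext (Bicategory.whisker_exchange η.val θ.val)
  pentagon f g h i := hom₂_ext (Bicategory.pentagon f.val g.val h.val i.val)
  triangle f g := hom₂_ext (Bicategory.triangle f.val g.val)

end SubBicat

end Sub

/-! ### Losses -/

/-- When two losses count as equal: everywhere, or for almost every observation. -/
inductive LossEq
  | pointwise
  | almostSure

/-- `∀ᶠ y in e.filter μ` means "for all `y`", respectively "for `μ`-almost all `y`". -/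
def LossEq.filter (e : LossEq) {Y : MeasCat.{u}} (μ : ProbabilityMeasure Y) : Filter Y :=
  match e with
  | .pointwise => ⊤
  | .almostSure => ae (μ : Measure Y)

/-- State-dependent effects: for each state on `X`, a measurable `[0, ∞]`-valued function. -/
@[ext]
structure Loss (X Y : MeasCat.{u}) where
  val : ProbabilityMeasure X → Y → ℝ≥0∞
  measurable : ∀ π, Measurable (val π)

section Losses

variable {W X Y Z : MeasCat.{u}} {e : LossEq}

def Loss.setoid (e : LossEq) (μ : ProbabilityMeasure X → ProbabilityMeasure Y) :
    Setoid (Loss X Y) where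
  r L L' := ∀ π, ∀ᶠ y in e.filter (μ π), L.val π y = L'.val π y
  iseqv := ⟨fun _ _ => .of_forall fun _ => rfl, fun h π => (h π).mono fun _ h => h.symm,
    fun h h' π => (h π).mp ((h' π).mono fun _ h' h => h.trans h')⟩

/-- Losses up to equality at the observations predicted by `μ`. -/
def LossClass (e : LossEq) (μ : ProbabilityMeasure X → ProbabilityMeasure Y) : Type u :=
  Quotient (Loss.setoid e μ)

namespace LossClass

variable {μ : ProbabilityMeasure X → ProbabilityMeasure Y}

/-- The class of a loss. -/
def mk (e : LossEq) (μ : ProbabilityMeasure X → ProbabilityMeasure Y) (L : Loss X Y) :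
    LossClass e μ :=
  Quotient.mk (Loss.setoid e μ) L

theorem ind {p : LossClass e μ → Prop} (h : ∀ L, p (mk e μ L)) (L : LossClass e μ) : p L :=
  Quotient.ind h L

theorem mk_eq_mk {L L' : Loss X Y} (h : ∀ π y, L.val π y = L'.val π y) :
    mk e μ L = mk e μ L' :=
  Quotient.sound fun π => .of_forall (h π)

instance : Zero (LossClass e μ) := ⟨mk e μ ⟨fun _ _ => 0, fun _ => measurable_const⟩⟩

noncomputable instance : Add (LossClass e μ) where
  add := Quotient.map₂
    (fun L L' => ⟨fun π y => L.val π y + L'.val π y, fun π => (L.measurable π).add (L'.measurable π)⟩)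
    fun _ _ h _ _ h' π => (h π).mp ((h' π).mono fun _ h' h => congrArg₂ (· + ·) h h')

noncomputable instance : AddCommMonoid (LossClass e μ) where
  add_assoc a b c := by
    induction a using ind; induction b using ind; induction c using ind
    exact mk_eq_mk fun _ _ => add_assoc _ _ _
  zero_add a := by
    induction a using ind
    exact mk_eq_mk fun _ _ => zero_add _
  add_zero a := by
    induction a using ind
    exact mk_eq_mk fun _ _ => add_zero _
  add_comm a b := by
    induction a using ind; induction b using ind
    exact mk_eq_mk fun _ _ => add_comm _ _
  nsmul := nsmulRec

/-- Transport along an equality of predictions. -/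
def cast {μ' : ProbabilityMeasure X → ProbabilityMeasure Y} (h : ∀ π, μ' π = μ π) :
    LossClass e μ →+ LossClass e μ' where
  toFun := Quotient.map id fun L L' hL π => by rw [h π]; exact hL π
  map_zero' := rfl
  map_add' a b := by
    induction a using ind; induction b using ind
    rfl

/-- Reindexing along a prediction `μ`: the state on `X` is pushed forward to `Y`. -/
def reindex (μ : ProbabilityMeasure X → ProbabilityMeasure Y)
    {ν : ProbabilityMeasure Y → ProbabilityMeasure Z}
    {ρ : ProbabilityMeasure X → ProbabilityMeasure Z} (h : ∀ π, ρ π = ν (μ π)) :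
    LossClass e ν →+ LossClass e ρ where
  toFun := Quotient.map (fun L => ⟨fun π => L.val (μ π), fun π => L.measurable (μ π)⟩)
    fun L L' hL π => by rw [h π]; exact hL (μ π)
  map_zero' := rfl
  map_add' a b := by
    induction a using ind; induction b using ind
    rfl

/-- Precomposition of a state-dependent effect with the state-dependent channel `κ`. -/
noncomputable def pull (κ : ProbabilityMeasure X → Kernel Z Y)
    {ρ : ProbabilityMeasure X → ProbabilityMeasure Z}
    (hκ : ∀ π (S : Set Y), (∀ᶠ y in e.filter (μ π), y ∈ S) →
      ∀ᶠ z in e.filter (ρ π), ∀ᵐ y ∂(κ π z), y ∈ S) :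
    LossClass e μ →+ LossClass e ρ where
  toFun := Quotient.map
    (fun L => ⟨fun π z => ∫⁻ y, L.val π y ∂(κ π z), fun π => (L.measurable π).lintegral_kernel⟩)
    fun L L' hL π => (hκ π _ (hL π)).mono fun z hz => lintegral_congr_ae hz
  map_zero' := mk_eq_mk fun π z => lintegral_zero
  map_add' a b := by
    induction a using ind with | _ a =>
    induction b using ind with | _ b =>
    exact mk_eq_mk fun π z => lintegral_add_left (a.measurable π) _

end LossClass

end Losses

/-! ### Statistical games -/

/-- The backward channels of `B` ignore null sets of the prior, at almost every predicted observation.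
This is no condition for `LossEq.pointwise`. -/
def Nonsingular (B : SubBicat BLens.{u}) (e : LossEq) : Prop :=
  ∀ {X Y : B.Obj} (f : X ⟶ Y) (π : ProbabilityMeasure X.val.space) (S : Set X.val.space),
    (∀ᶠ x in e.filter π, x ∈ S) →
      ∀ᶠ y in e.filter (f.val.fwd.pred π), ∀ᵐ x ∂((f.val.bwd π).snd y), x ∈ S

/-- 0-cells of the bicategory of statistical games over `B`. -/
structure SGame (B : SubBicat BLens.{u}) (e : LossEq) (hB : Nonsingular B e) where
  base : B.Obj

namespace SGame

variable {B : SubBicat BLens.{u}} {e : LossEq} {hB : Nonsingular B e}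

/-- The type of losses for a lens. -/
abbrev LossOf (e : LossEq) {X Y : B.Obj} (f : X ⟶ Y) : Type u := LossClass e f.val.fwd.pred

theorem pred_eq {X Y : B.Obj} {f g : X ⟶ Y} (η : f ⟶ g) (π) :
    f.val.fwd.pred π = g.val.fwd.pred π :=
  Chan.pred_eq η.val.fwd π

theorem pred_comp {X Y Z : B.Obj} (f : X ⟶ Y) (g : Y ⟶ Z) (π) :
    (f ≫ g).val.fwd.pred π = g.val.fwd.pred (f.val.fwd.pred π) :=
  Chan.pred_comp f.val.fwd g.val.fwd π

/-- Transport of a loss along a 2-cell. -/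
noncomputable def castLoss {X Y : B.Obj} {f g : X ⟶ Y} (η : f ⟶ g) : LossOf e g →+ LossOf e f :=
  LossClass.cast (pred_eq η)

theorem castLoss_self {X Y : B.Obj} {f : X ⟶ Y} (η : f ⟶ f) (L : LossOf e f) :
    castLoss η L = L := by
  induction L using LossClass.ind
  rfl

theorem castLoss_comp {X Y : B.Obj} {f g h : X ⟶ Y} (η : f ⟶ g) (θ : g ⟶ h) (L : LossOf e h) :
    castLoss (η ≫ θ) L = castLoss η (castLoss θ L) := by
  induction L using LossClass.ind
  rfl

theorem pred_id {X : B.Obj} (π) : (𝟙 X : X ⟶ X).val.fwd.pred π = π :=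
  Chan.pred_id (X := X.val.space) π

theorem snd_eq {X Y : B.Obj} {f g : X ⟶ Y} (η : f ⟶ g) (π) :
    (f.val.bwd π).snd = (g.val.bwd π).snd := by
  obtain ⟨φ, hφ⟩ := Quotient.exists_rep (η.val.bwd π)
  refine kernel_ext_lintegral fun y F hF => ?_
  rw [Kernel.lintegral_snd _ _ hF, Kernel.lintegral_snd _ _ hF, φ.lintegral_tgt _ (by fun_prop)]
  simp

theorem lintegral_comp_snd {X Y Z : B.Obj} (f : X ⟶ Y) (g : Y ⟶ Z) (π) (z : Z.val.space)
    {F : X.val.space → ℝ≥0∞} (hF : Measurable F) :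
    ∫⁻ x, F x ∂(((f ≫ g).val.bwd π).snd z) =
      ∫⁻ y, ∫⁻ x, F x ∂((f.val.bwd π).snd y) ∂((g.val.bwd (f.val.fwd.pred π)).snd z) := by
  have h := lintegral_bseq (f.val.bwd π) (g.val.bwd (f.val.fwd.pred π)) z
    (F := fun t => F t.2) (by fun_prop)
  have hm : Measurable fun y => ∫⁻ x, F x ∂((f.val.bwd π).snd y) := hF.lintegral_kernel
  rw [Kernel.lintegral_snd _ _ hF, Kernel.lintegral_snd _ _ hm]
  refine h.trans (lintegral_congr fun t => ?_)
  rw [Kernel.lintegral_snd _ _ hF]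

theorem lintegral_id_snd {X : B.Obj} (π) (x : X.val.space)
    {F : X.val.space → ℝ≥0∞} (hF : Measurable F) :
    ∫⁻ t, F t ∂(((𝟙 X : X ⟶ X).val.bwd π).snd x) = F x := by
  rw [Kernel.lintegral_snd _ _ hF]
  exact lintegral_idKer x (F := fun t => F t.2) (by fun_prop)

/-- Reindexing of losses for `g` along `f`. -/
noncomputable def reindex {X Y Z : B.Obj} (f : X ⟶ Y) (g : Y ⟶ Z) :
    LossOf e g →+ LossOf e (f ≫ g) :=
  LossClass.reindex f.val.fwd.pred (pred_comp f g)

/-- Precomposition of losses for `f` with the backward channel of `g`, reindexed along `f`, the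
coparameter being discarded. -/
noncomputable def pull (hB : Nonsingular B e) {X Y Z : B.Obj} (f : X ⟶ Y) (g : Y ⟶ Z) :
    LossOf e f →+ LossOf e (f ≫ g) :=
  LossClass.pull (fun π => (g.val.bwd (f.val.fwd.pred π)).snd) fun π S hS => by
    rw [pred_comp]
    exact hB g (f.val.fwd.pred π) S hS

/-- 1-cells: a lens with a loss. -/
@[ext]
structure Game (X Y : SGame B e hB) where
  lens : X.base ⟶ Y.base
  loss : LossOf e lens

noncomputable instance : CategoryStruct (SGame B e hB) where
  Hom := Game
  id X := ⟨𝟙 X.base, 0⟩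
  comp f g := ⟨f.lens ≫ g.lens, reindex f.lens g.lens g.loss + pull hB f.lens g.lens f.loss⟩

/-- 2-cells: a 2-cell of lenses with the difference of the losses. -/
@[ext]
structure Hom₂ {X Y : SGame B e hB} (f g : X ⟶ Y) where
  cell : f.lens ⟶ g.lens
  loss : LossOf e f.lens
  eq : f.loss = castLoss cell g.loss + loss

noncomputable instance homCategory (X Y : SGame B e hB) : Category (X ⟶ Y) where
  Hom := Hom₂
  id f := ⟨𝟙 f.lens, 0, by
    obtain ⟨f, L⟩ := f
    induction L using LossClass.ind with | _ L =>
    exact LossClass.mk_eq_mk fun π y => (add_zero _).symm⟩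
  comp {f g h} η θ := ⟨η.cell ≫ θ.cell, castLoss η.cell θ.loss + η.loss, by
    rw [η.eq, θ.eq, map_add, ← castLoss_comp, add_assoc]⟩
  id_comp η := Hom₂.ext (Category.id_comp η.cell) (by
    obtain ⟨_, K, _⟩ := η
    induction K using LossClass.ind with | _ K =>
    exact LossClass.mk_eq_mk fun π y => add_zero _)
  comp_id η := Hom₂.ext (Category.comp_id η.cell) (by
    obtain ⟨_, K, _⟩ := η
    induction K using LossClass.ind with | _ K =>
    exact LossClass.mk_eq_mk fun π y => zero_add _)
  assoc η θ ζ := Hom₂.ext (Category.assoc η.cell θ.cell ζ.cell) (by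
    obtain ⟨_, K, _⟩ := η
    obtain ⟨_, K', _⟩ := θ
    obtain ⟨_, K'', _⟩ := ζ
    induction K using LossClass.ind with | _ K =>
    induction K' using LossClass.ind with | _ K' =>
    induction K'' using LossClass.ind with | _ K'' =>
    exact LossClass.mk_eq_mk fun π y => (add_assoc _ _ _).symm)

theorem hom₂_ext {X Y : SGame B e hB} {f g : X ⟶ Y} {η θ : f ⟶ g} (h : η.cell = θ.cell)
    (h' : η.loss = θ.loss) : η = θ :=
  Hom₂.ext h h'

open Bicategory

/-- Left whiskering. -/
noncomputable def whiskerLeft {X Y Z : SGame B e hB} (f : X ⟶ Y) {g h : Y ⟶ Z} (η : g ⟶ h) :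
    f ≫ g ⟶ f ≫ h :=
  Hom₂.mk (f := f ≫ g) (g := f ≫ h) (f.lens ◁ η.cell) (reindex f.lens g.lens η.loss) (by
    obtain ⟨f, L⟩ := f
    obtain ⟨g, L₁⟩ := g
    obtain ⟨h, L₂⟩ := h
    obtain ⟨η, K, hK⟩ := η
    change reindex f g L₁ + pull hB f g L =
      castLoss (f ◁ η) (reindex f h L₂ + pull hB f h L) + reindex f g K
    change L₁ = castLoss η L₂ + K at hK
    rw [hK]
    induction L using LossClass.ind with | _ L =>
    induction L₂ using LossClass.ind with | _ L₂ =>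
    induction K using LossClass.ind with | _ K =>
    refine LossClass.mk_eq_mk fun π y => ?_
    change L₂.val _ y + K.val _ y + ∫⁻ x, L.val π x ∂((g.val.bwd (f.val.fwd.pred π)).snd y) =
      L₂.val _ y + ∫⁻ x, L.val π x ∂((h.val.bwd (f.val.fwd.pred π)).snd y) + K.val _ y
    rw [snd_eq η]
    exact add_right_comm _ _ _)

/-- Right whiskering. -/
noncomputable def whiskerRight {X Y Z : SGame B e hB} {f g : X ⟶ Y} (η : f ⟶ g) (h : Y ⟶ Z) :
    f ≫ h ⟶ g ≫ h :=
  Hom₂.mk (f := f ≫ h) (g := g ≫ h) (η.cell ▷ h.lens) (pull hB f.lens h.lens η.loss) (by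
    obtain ⟨f, L⟩ := f
    obtain ⟨g, L₁⟩ := g
    obtain ⟨h, L₂⟩ := h
    obtain ⟨η, K, hK⟩ := η
    change reindex f h L₂ + pull hB f h L =
      castLoss (η ▷ h) (reindex g h L₂ + pull hB g h L₁) + pull hB f h K
    change L = castLoss η L₁ + K at hK
    rw [hK, map_add]
    induction L₁ using LossClass.ind with | _ L₁ =>
    induction L₂ using LossClass.ind with | _ L₂ =>
    induction K using LossClass.ind with | _ K =>
    refine LossClass.mk_eq_mk fun π y => ?_
    change L₂.val (f.val.fwd.pred π) y + (∫⁻ x, L₁.val π x ∂((h.val.bwd (f.val.fwd.pred π)).snd y) +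
        ∫⁻ x, K.val π x ∂((h.val.bwd (f.val.fwd.pred π)).snd y)) =
      L₂.val (g.val.fwd.pred π) y + ∫⁻ x, L₁.val π x ∂((h.val.bwd (g.val.fwd.pred π)).snd y) +
        ∫⁻ x, K.val π x ∂((h.val.bwd (f.val.fwd.pred π)).snd y)
    rw [pred_eq η]
    exact (add_assoc _ _ _).symm)

theorem assoc_loss {W X Y Z : SGame B e hB} (f : W ⟶ X) (g : X ⟶ Y) (h : Y ⟶ Z) :
    ((f ≫ g) ≫ h).loss = castLoss (α_ f.lens g.lens h.lens).hom (f ≫ g ≫ h).loss := by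
  obtain ⟨f, L⟩ := f
  obtain ⟨g, L₁⟩ := g
  obtain ⟨h, L₂⟩ := h
  induction L using LossClass.ind with | _ L =>
  induction L₁ using LossClass.ind with | _ L₁ =>
  induction L₂ using LossClass.ind with | _ L₂ =>
  refine LossClass.mk_eq_mk fun π y => ?_
  change L₂.val ((f ≫ g).val.fwd.pred π) y +
      ∫⁻ x, (L₁.val (f.val.fwd.pred π) x +
        ∫⁻ t, L.val π t ∂((g.val.bwd (f.val.fwd.pred π)).snd x))
        ∂((h.val.bwd ((f ≫ g).val.fwd.pred π)).snd y) =
    (L₂.val (g.val.fwd.pred (f.val.fwd.pred π)) y +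
      ∫⁻ x, L₁.val (f.val.fwd.pred π) x
        ∂((h.val.bwd (g.val.fwd.pred (f.val.fwd.pred π))).snd y)) +
      ∫⁻ t, L.val π t ∂(((g ≫ h).val.bwd (f.val.fwd.pred π)).snd y)
  rw [pred_comp, lintegral_comp_snd _ _ _ _ (L.measurable π),
    lintegral_add_left (L₁.measurable _), add_assoc]

theorem leftUnitor_loss {X Y : SGame B e hB} (f : X ⟶ Y) :
    (𝟙 X ≫ f).loss = castLoss (λ_ f.lens).hom f.loss := by
  obtain ⟨f, L⟩ := f
  induction L using LossClass.ind with | _ L =>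
  refine LossClass.mk_eq_mk fun π y => ?_
  change L.val ((𝟙 X.base : X.base ⟶ X.base).val.fwd.pred π) y +
    ∫⁻ _, 0 ∂((f.val.bwd ((𝟙 X.base : X.base ⟶ X.base).val.fwd.pred π)).snd y) = L.val π y
  rw [lintegral_zero, add_zero, pred_id]

theorem rightUnitor_loss {X Y : SGame B e hB} (f : X ⟶ Y) :
    (f ≫ 𝟙 Y).loss = castLoss (ρ_ f.lens).hom f.loss := by
  obtain ⟨f, L⟩ := f
  induction L using LossClass.ind with | _ L =>
  refine LossClass.mk_eq_mk fun π y => ?_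
  change 0 + ∫⁻ x, L.val π x
    ∂(((𝟙 Y.base : Y.base ⟶ Y.base).val.bwd (f.val.fwd.pred π)).snd y) = L.val π y
  rw [zero_add, lintegral_id_snd _ _ (L.measurable π)]

/-- An invertible 2-cell of lenses along which the losses agree. -/
noncomputable def isoOf {X Y : SGame B e hB} {f g : X ⟶ Y} (α : f.lens ≅ g.lens)
    (h : f.loss = castLoss α.hom g.loss) : f ≅ g where
  hom := ⟨α.hom, 0, by rw [add_zero]; exact h⟩
  inv := ⟨α.inv, 0, by
    rw [add_zero, h, ← castLoss_comp, castLoss_self]⟩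
  hom_inv_id := hom₂_ext α.hom_inv_id (by
    change castLoss α.hom 0 + 0 = 0
    rw [map_zero, add_zero])
  inv_hom_id := hom₂_ext α.inv_hom_id (by
    change castLoss α.inv 0 + 0 = 0
    rw [map_zero, add_zero])

/-- Horizontal composition of 2-cells `(α, K) : f ⟶ f'` and `(β, K') : g ⟶ g'` is
`(α ▷ g) ≫ (f' ◁ β)`, with loss `reindex K' + pull K`. -/
noncomputable instance : Bicategory (SGame B e hB) where
  homCategory := homCategory
  whiskerLeft f _ _ η := whiskerLeft f η
  whiskerRight η h := whiskerRight η h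
  associator f g h := isoOf (α_ f.lens g.lens h.lens) (assoc_loss f g h)
  leftUnitor f := isoOf (λ_ f.lens) (leftUnitor_loss f)
  rightUnitor f := isoOf (ρ_ f.lens) (rightUnitor_loss f)
  whiskerLeft_id f g := hom₂_ext (Bicategory.whiskerLeft_id f.lens g.lens) (map_zero _)
  whiskerLeft_comp f g h i η θ :=
    hom₂_ext (Bicategory.whiskerLeft_comp f.lens η.cell θ.cell) (by
      obtain ⟨η, K, _⟩ := η
      obtain ⟨θ, K', _⟩ := θ
      induction K using LossClass.ind with | _ K =>
      induction K' using LossClass.ind with | _ K' =>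
      exact LossClass.mk_eq_mk fun π y => rfl)
  id_whiskerLeft {X Y f g} η := hom₂_ext (Bicategory.id_whiskerLeft η.cell) (by
    obtain ⟨η, K, _⟩ := η
    induction K using LossClass.ind with | _ K =>
    refine LossClass.mk_eq_mk fun π y => ?_
    change K.val ((𝟙 X.base : X.base ⟶ X.base).val.fwd.pred π) y = 0 + K.val π y + 0
    rw [pred_id, zero_add, add_zero])
  comp_whiskerLeft f g _ _ η := hom₂_ext (Bicategory.comp_whiskerLeft f.lens g.lens η.cell) (by
    obtain ⟨η, K, _⟩ := η
    induction K using LossClass.ind with | _ K =>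
    refine LossClass.mk_eq_mk fun π y => ?_
    change K.val ((f ≫ g).lens.val.fwd.pred π) y =
      0 + K.val (g.lens.val.fwd.pred (f.lens.val.fwd.pred π)) y + 0
    rw [← pred_comp, zero_add, add_zero]
    rfl)
  id_whiskerRight f g := hom₂_ext (Bicategory.id_whiskerRight f.lens g.lens) (map_zero _)
  comp_whiskerRight η θ i := hom₂_ext (Bicategory.comp_whiskerRight η.cell θ.cell i.lens) (by
    obtain ⟨η, K, _⟩ := η
    obtain ⟨θ, K', _⟩ := θ
    induction K using LossClass.ind with | _ K =>
    induction K' using LossClass.ind with | _ K' =>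
    refine LossClass.mk_eq_mk fun π y => ?_
    refine (lintegral_add_left (K'.measurable π) _).trans ?_
    change ∫⁻ x, K'.val π x ∂((i.lens.val.bwd _).snd y) + _ =
      ∫⁻ x, K'.val π x ∂((i.lens.val.bwd _).snd y) + _
    rw [pred_eq η])
  whiskerRight_id {X Y f g} η := hom₂_ext (Bicategory.whiskerRight_id η.cell) (by
    obtain ⟨η, K, _⟩ := η
    induction K using LossClass.ind with | _ K =>
    refine LossClass.mk_eq_mk fun π y => ?_
    change ∫⁻ x, K.val π x
      ∂(((𝟙 Y.base : Y.base ⟶ Y.base).val.bwd (f.lens.val.fwd.pred π)).snd y) = 0 + K.val π y + 0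
    rw [lintegral_id_snd _ _ (K.measurable π), zero_add, add_zero])
  whiskerRight_comp {W X Y Z f f'} η g h :=
    hom₂_ext (Bicategory.whiskerRight_comp η.cell g.lens h.lens) (by
      obtain ⟨η, K, _⟩ := η
      induction K using LossClass.ind with | _ K =>
      refine LossClass.mk_eq_mk fun π y => ?_
      change ∫⁻ x, K.val π x ∂(((g.lens ≫ h.lens).val.bwd (f.lens.val.fwd.pred π)).snd y) =
        0 + ∫⁻ x, ∫⁻ t, K.val π t ∂((g.lens.val.bwd (f.lens.val.fwd.pred π)).snd x)
          ∂((h.lens.val.bwd ((f.lens ≫ g.lens).val.fwd.pred π)).snd y) + 0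
      rw [lintegral_comp_snd _ _ _ _ (K.measurable π), pred_comp, zero_add, add_zero])
  whisker_assoc {W X Y Z} f g g' η h :=
    hom₂_ext (Bicategory.whisker_assoc f.lens η.cell h.lens) (by
      obtain ⟨η, K, _⟩ := η
      induction K using LossClass.ind with | _ K =>
      refine LossClass.mk_eq_mk fun π y => ?_
      change ∫⁻ x, K.val (f.lens.val.fwd.pred π) x
          ∂((h.lens.val.bwd ((f.lens ≫ g.lens).val.fwd.pred π)).snd y) =
        0 + ∫⁻ x, K.val (f.lens.val.fwd.pred π) x
          ∂((h.lens.val.bwd (g.lens.val.fwd.pred (f.lens.val.fwd.pred π))).snd y) + 0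
      rw [pred_comp, zero_add, add_zero])
  whisker_exchange {X Y Z f g h i} η θ :=
    hom₂_ext (Bicategory.whisker_exchange η.cell θ.cell) (by
      obtain ⟨η, K, _⟩ := η
      obtain ⟨θ, K', _⟩ := θ
      induction K using LossClass.ind with | _ K =>
      induction K' using LossClass.ind with | _ K' =>
      refine LossClass.mk_eq_mk fun π y => ?_
      change ∫⁻ x, K.val π x ∂((i.lens.val.bwd (f.lens.val.fwd.pred π)).snd y) +
          K'.val (f.lens.val.fwd.pred π) y =
        K'.val (g.lens.val.fwd.pred π) y +
          ∫⁻ x, K.val π x ∂((h.lens.val.bwd (f.lens.val.fwd.pred π)).snd y)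
      rw [snd_eq θ, pred_eq η]
      exact add_comm _ _)
  pentagon f g h i := hom₂_ext (Bicategory.pentagon f.lens g.lens h.lens i.lens) (by
    refine LossClass.mk_eq_mk fun π y => ?_
    change 0 + 0 + ∫⁻ _, 0 ∂_ = (0 : ℝ≥0∞) + 0
    simp)
  triangle f g := hom₂_ext (Bicategory.triangle f.lens g.lens) (by
    refine LossClass.mk_eq_mk fun π y => ?_
    change (0 : ℝ≥0∞) + 0 = ∫⁻ _, 0 ∂_
    simp)

/-- The projection forgetting losses. -/
noncomputable def proj (B : SubBicat BLens.{u}) (e : LossEq) (hB : Nonsingular B e) :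
    StrictPseudofunctor (SGame B e hB) B.Obj :=
  StrictPseudofunctor.mk'
    { obj X := X.base
      map f := f.lens
      map₂ η := η.cell
      map₂_id _ := rfl
      map₂_comp _ _ := rfl
      map_id _ := rfl
      map_comp _ _ := rfl
      map₂_whisker_left f _ _ η := by
        rw [eqToHom_refl, eqToHom_refl, Category.comp_id, Category.id_comp]
        rfl
      map₂_whisker_right η f := by
        rw [eqToHom_refl, eqToHom_refl, Category.comp_id, Category.id_comp]
        rfl
      map₂_left_unitor f := by
        rw [eqToHom_refl, Category.id_comp]
        rfl
      map₂_right_unitor f := by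
        rw [eqToHom_refl, Category.id_comp]
        rfl
      map₂_associator f g h := by
        rw [eqToHom_refl, eqToHom_refl, Category.comp_id, Category.id_comp]
        rfl }


/-- The assignment `L` of losses to the 1-cells of `B` extends to a strict 2-functor which is a
section of the projection to `B`, that is, to a strict loss model. -/
def IsStrictLossModel (hB : Nonsingular B e) (L : ∀ {X Y : B.Obj} (f : X ⟶ Y), LossOf e f) :
    Prop :=
  ∃ F : StrictPseudofunctor B.Obj (SGame B e hB),
    F.toPrefunctor = { obj X := ⟨X⟩, map f := ⟨f, L f⟩ } ∧
    F.comp (proj B e hB) = StrictPseudofunctor.id B.Obj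

end SGame

/-! ### Bayesian inversion and densities -/

/-- `ρ` is a Bayesian inversion of `c` with respect to `π`: drawing `x` from `π` and then `(m, y)`
from `c x` gives the same law of `(x, m, y)` as drawing `y` from the prediction and then `(m, x)`
from `ρ y`. -/
def IsBayesInversion {X Y : MeasCat.{u}} (c : Chan X Y) (π : ProbabilityMeasure X)
    (ρ : Kernel Y (c.M × X)) : Prop :=
  (π : Measure X) ⊗ₘ c.ker =
    ((c.pred π : Measure Y) ⊗ₘ ρ).map (fun t => (t.2.2, t.2.1, t.1))

/-- A choice of backward channels for all coparameterized channels and priors. -/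
abbrev Inversion : Type (u + 1) :=
  ∀ {X Y : MeasCat.{u}} (c : Chan X Y), ProbabilityMeasure X → Kernel Y (c.M × X)

/-- `dag` consists of exact inversions of the forward channels of `B`. -/
def Inversion.IsExactOn (dag : Inversion.{u}) (B : SubBicat BLens.{u}) : Prop :=
  ∀ {X Y : B.Obj} (f : X ⟶ Y) (π : ProbabilityMeasure X.val.space),
    IsMarkovKernel (dag f.val.fwd π) ∧ IsBayesInversion f.val.fwd π (dag f.val.fwd π)

/-- `dag` is strictly compatible with identities and copy-composition of channels of `B`. -/
def Inversion.IsStrictOn (dag : Inversion.{u}) (B : SubBicat BLens.{u}) : Prop :=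
  (∀ (X : B.Obj) (π : ProbabilityMeasure X.val.space),
    dag (Chan.id X.val.space) π = idKer X.val.space) ∧
  ∀ {X Y Z : B.Obj} (f : X ⟶ Y) (g : Y ⟶ Z) (π : ProbabilityMeasure X.val.space),
    dag (f.val.fwd.comp g.val.fwd) π =
      bseq (dag f.val.fwd π) (dag g.val.fwd (f.val.fwd.pred π))

/-- At the observations predicted by `μ`, the channels `ρ` and `σ` have jointly measurable densities
with respect to a common measure, which may depend on the observation. -/
def HasDensities (e : LossEq) {Y T : MeasCat.{u}} (μ : ProbabilityMeasure Y)
    (ρ σ : Kernel Y T) : Prop :=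
  ∃ (ν : Y → Measure T) (p q : Y → T → ℝ≥0∞),
    Measurable (Function.uncurry p) ∧ Measurable (Function.uncurry q) ∧
    ∀ᶠ y in e.filter μ, ρ y = (ν y).withDensity (p y) ∧ σ y = (ν y).withDensity (q y)

end StatGames

open StatGames

namespace StatGames

open InformationTheory

/-! ### Relative entropy from jointly measurable Lebesgue decompositions. -/

section KLDiv

variable {S T : Type*} [MeasurableSpace S] [MeasurableSpace T]

/-! The heart of the matter is the chain rule of relative entropy. The backward channel of a
composite lens draws `y` from `d'` and then `x` from `c'`, and the coparameter of a copy-composite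
remembers `y`. Up to a reordering of coordinates its law is therefore the full joint law of all the
draws, and so is that of the composite of the chosen inversions. The divergence of the two joint
laws is exactly the divergence at the first stage plus the divergence at the second stage averaged
over `d'`, which is the formula for the loss of a composite game. All terms lie in `[0, ∞]`, so no
finiteness or absolute continuity is needed.

Three points need care. (1) The chain rule `klDiv_compProd_bseq` expresses the second term as a
divergence of composition-products, whereas the loss is an integral of fibrewise divergences. The
joint densities `p` and `q` supply, for all fibres at once, the Lebesgue decomposition with density
`p / q` and singular set `{q = 0}`; these decompositions assemble to one of the joint laws, and
`klDiv_compProd_eq_lintegral` follows, as does measurability of the loss.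

(2) Equality of losses, in either sense, is tested by integrating against finite measures `μ'` with
`ae μ' ≤ e.filter μ`: Dirac masses in the pointwise case, restrictions of the predictive law in the
almost sure case (`LossEq.eventually_eq_of_lintegral_eq`). Both cases then become one identity
between divergences of joint laws. Nonsingularity ensures that the averaging over `d'` never sees
the null set on which the loss of `c` is undetermined.

(3) The inversion of a composite must be the composite of the inversions under `μ'`. This is assumed
in the pointwise case; in the almost sure case it holds because inversions compose
(`IsBayesInversion.comp`) and are almost surely unique (`IsBayesInversion.compProd_eq`).

The rest is formal. Losses that vanish on identities and are additive along composition are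
invariant under the generating structural 2-cells, hence under all 2-cells (`loss_eq_castLoss`), so
every 2-cell lifts to games with `K = 0`, and this lift is strictly functorial (`lossModel`). -/

theorem klDiv_map_equiv (e : S ≃ᵐ T) (P Q : Measure S) [IsFiniteMeasure P] [IsFiniteMeasure Q] :
    klDiv (P.map e) (Q.map e) = klDiv P Q := by
  -- The data processing inequality, applied to the equivalence and to its inverse.
  refine le_antisymm (klDiv_map_le P Q e.measurable) ?_
  have := klDiv_map_le (P.map e) (Q.map e) e.symm.measurable
  simpa [Measure.map_map e.symm.measurable e.measurable] using this

/-- `r` and `A` are the density and the support of the singular part in a Lebesgue decomposition of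
`P` with respect to `Q`. -/
structure IsLebesgueDecomp (P Q : Measure T) (r : T → ℝ≥0∞) (A : Set T) : Prop where
  null : Q A = 0
  eq : P = Q.withDensity r + P.restrict A

open Classical in
/-- The relative entropy computed from a Lebesgue decomposition. -/
noncomputable def klOf (P Q : Measure T) (r : T → ℝ≥0∞) (A : Set T) : ℝ≥0∞ :=
  if P A = 0 then ∫⁻ t, ENNReal.ofReal (klFun (r t).toReal) ∂Q else ∞

/-- If the singular part vanishes, `r` is a version of the Radon-Nikodym derivative; if it does not,
`A` is `Q`-null but charged by `P`, so absolute continuity fails. The gain is that `r` and `A` are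
at our disposal and can be chosen measurably in a parameter. -/
theorem IsLebesgueDecomp.klDiv_eq {P Q : Measure T} [IsFiniteMeasure P] [IsFiniteMeasure Q]
    {r : T → ℝ≥0∞} {A : Set T} (h : IsLebesgueDecomp P Q r A) (hr : Measurable r) :
    klDiv P Q = klOf P Q r A := by
  unfold klOf
  split_ifs with hA
  · have hP : P = Q.withDensity r := by
      conv_lhs => rw [h.eq, Measure.restrict_eq_zero.2 hA, add_zero]
    have hac : P ≪ Q := hP ▸ withDensity_absolutelyContinuous Q r
    rw [klDiv_eq_lintegral_klFun_of_ac hac]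
    have hd : P.rnDeriv Q =ᵐ[Q] r := by
      conv_lhs => rw [hP]
      exact Measure.rnDeriv_withDensity Q hr
    refine lintegral_congr_ae (hd.mono fun t ht => ?_)
    dsimp only
    rw [ht]
  · exact klDiv_of_not_ac fun hac => hA (hac h.null)

/-- Off the zeros of `q` the density of `P` with respect to `Q` is the quotient; on the zeros lies
the part of `P` that `Q` cannot see. The value of `p / q` there is immaterial, since that set is
`Q`-null. -/
theorem isLebesgueDecomp_of_densities {P Q ν : Measure T} [IsFiniteMeasure P] [IsFiniteMeasure Q]
    {p q : T → ℝ≥0∞} (hp : Measurable p) (hq : Measurable q) (hP : P = ν.withDensity p)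
    (hQ : Q = ν.withDensity q) :
    IsLebesgueDecomp P Q (fun t => p t / q t) {t | q t = 0} := by
  have hA : MeasurableSet {t | q t = 0} := hq (measurableSet_singleton 0)
  -- The cancellation `q * (p / q) = p` fails where `q = ∞`; finiteness of `Q` makes this a `ν`-null
  -- set.
  have hfin : ∀ᵐ t ∂ν, q t < ∞ := by
    refine ae_lt_top hq ?_
    rw [← setLIntegral_univ, ← withDensity_apply _ .univ, ← hQ]
    exact measure_ne_top _ _
  refine ⟨?_, ?_⟩
  · rw [hQ, withDensity_apply _ hA]
    exact (setLIntegral_congr_fun hA fun t ht => ht).trans (by simp)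
  · have h1 : Q.withDensity (fun t => p t / q t) = P.restrict {t | q t = 0}ᶜ := by
      rw [hQ, ← withDensity_mul (g := fun t => p t / q t) _ hq (hp.div hq), hP, restrict_withDensity hA.compl,
        ← withDensity_indicator hA.compl]
      refine withDensity_congr_ae (hfin.mono fun t ht => ?_)
      by_cases h0 : q t = 0
      · simp [h0]
      · simp only [Pi.mul_apply, Set.indicator, Set.mem_compl_iff, Set.mem_ofPred_eq, h0,
          not_false_eq_true, if_true]
        exact ENNReal.mul_div_cancel h0 ht.ne
    rw [h1, add_comm, Measure.restrict_add_restrict_compl hA]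

/-- The relative entropy is replaced by `klOf` for the sake of this: with `r` and `A` given jointly
on `S × T`, the mass of a section and the integral along a fibre are both measurable in `s`. -/
theorem measurable_klOf (κ η : Kernel S T) [IsFiniteKernel κ] [IsFiniteKernel η]
    {r : S → T → ℝ≥0∞} (hr : Measurable (Function.uncurry r)) {A : Set (S × T)}
    (hA : MeasurableSet A) : Measurable fun s => klOf (κ s) (η s) (r s) (Prod.mk s ⁻¹' A) := by
  refine Measurable.ite (Kernel.measurable_kernel_prodMk_left hA (measurableSet_singleton 0))
    ?_ measurable_const
  refine Measurable.lintegral_kernel_prod_right' (f := fun x : S × T =>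
    ENNReal.ofReal (klFun (Function.uncurry r x).toReal)) ?_
  fun_prop

/-- Both composition-products have the same base `μ`, so the density of one with respect to the
other is the density along the fibres. On a measurable set `E` each condition is the `μ`-integral of
the corresponding condition for the sections. -/
theorem IsLebesgueDecomp.compProd {μ : Measure S} [IsFiniteMeasure μ] {κ η : Kernel S T}
    [IsFiniteKernel κ] [IsFiniteKernel η] {r : S → T → ℝ≥0∞}
    (hr : Measurable (Function.uncurry r)) {A : Set (S × T)} (hA : MeasurableSet A)
    (h : ∀ᵐ s ∂μ, IsLebesgueDecomp (κ s) (η s) (r s) (Prod.mk s ⁻¹' A)) :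
    IsLebesgueDecomp (μ ⊗ₘ κ) (μ ⊗ₘ η) (Function.uncurry r) A := by
  refine ⟨?_, ?_⟩
  · rw [Measure.compProd_apply hA]
    exact (lintegral_congr_ae (h.mono fun s hs => hs.null)).trans lintegral_zero
  · ext E hE
    have hm : Measurable fun s => κ s (Prod.mk s ⁻¹' (E ∩ A)) :=
      Kernel.measurable_kernel_prodMk_left (hE.inter hA)
    rw [Measure.add_apply, Measure.restrict_apply hE, withDensity_apply _ hE,
      ← lintegral_indicator hE, Measure.lintegral_compProd (hr.indicator hE),
      Measure.compProd_apply hE, Measure.compProd_apply (hE.inter hA), ← lintegral_add_right _ hm]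
    refine lintegral_congr_ae (h.mono fun s hs => ?_)
    have hEs : MeasurableSet (Prod.mk s ⁻¹' E) := measurable_prodMk_left hE
    dsimp only
    conv_lhs => rw [hs.eq]
    rw [Measure.add_apply, Measure.restrict_apply hEs, withDensity_apply _ hEs,
      ← lintegral_indicator hEs]
    rfl

/-- If the singular set is null, almost all its sections are null and the claim is the
disintegration of an integral. Otherwise sections of positive mass occur with positive `μ`-measure;
there the integrand is `∞`, and both sides are infinite. -/
theorem klOf_compProd {μ : Measure S} [IsFiniteMeasure μ] {κ η : Kernel S T}
    [IsFiniteKernel κ] [IsFiniteKernel η] {r : S → T → ℝ≥0∞}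
    (hr : Measurable (Function.uncurry r)) {A : Set (S × T)} (hA : MeasurableSet A) :
    klOf (μ ⊗ₘ κ) (μ ⊗ₘ η) (Function.uncurry r) A =
      ∫⁻ s, klOf (κ s) (η s) (r s) (Prod.mk s ⁻¹' A) ∂μ := by
  have hm : Measurable fun s => κ s (Prod.mk s ⁻¹' A) := Kernel.measurable_kernel_prodMk_left hA
  by_cases h : (μ ⊗ₘ κ) A = 0
  · rw [klOf, if_pos h, Measure.lintegral_compProd (by fun_prop)]
    rw [Measure.compProd_apply hA, lintegral_eq_zero_iff hm] at h
    refine lintegral_congr_ae (h.mono fun s hs => ?_)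
    exact (if_pos hs).symm
  · rw [klOf, if_neg h]
    -- A finite integral would make `klOf` finite almost everywhere, so almost every section would
    -- be null, against `h`.
    by_contra hne
    have hlt := ae_lt_top (measurable_klOf κ η hr hA) (Ne.symm hne)
    rw [Measure.compProd_apply hA, lintegral_eq_zero_iff hm] at h
    refine h (hlt.mono fun s hs => ?_)
    by_contra h0
    rw [klOf, if_neg (by exact h0)] at hs
    exact lt_irrefl _ hs

/-- Conditional relative entropy is the mean of the fibrewise relative entropies. Joint
measurability of `r` and `A` takes the place of a countability assumption on the σ-algebra of `T`.
-/
theorem klDiv_compProd_eq_lintegral {μ : Measure S} [IsFiniteMeasure μ] {κ η : Kernel S T}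
    [IsFiniteKernel κ] [IsFiniteKernel η] {r : S → T → ℝ≥0∞}
    (hr : Measurable (Function.uncurry r)) {A : Set (S × T)} (hA : MeasurableSet A)
    (h : ∀ᵐ s ∂μ, IsLebesgueDecomp (κ s) (η s) (r s) (Prod.mk s ⁻¹' A)) :
    klDiv (μ ⊗ₘ κ) (μ ⊗ₘ η) = ∫⁻ s, klOf (κ s) (η s) (r s) (Prod.mk s ⁻¹' A) ∂μ :=
  ((IsLebesgueDecomp.compProd hr hA h).klDiv_eq hr).trans (klOf_compProd hr hA)

end KLDiv

/-! ### Relative entropy as a measurable function of the observation; testing equality by integrals.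
-/

/-- Relative entropies of channels with jointly measurable densities are measurable in the
observation, and they integrate to conditional relative entropies. -/
theorem HasDensities.exists_klDiv {e : LossEq} {Y T : MeasCat.{u}} {μ : ProbabilityMeasure Y}
    {ρ σ : Kernel Y T} [IsMarkovKernel ρ] [IsMarkovKernel σ] (h : HasDensities e μ ρ σ) :
    ∃ k : Y → ℝ≥0∞, Measurable k ∧ (∀ᶠ y in e.filter μ, k y = klDiv (ρ y) (σ y)) ∧
      ∀ {S : Type u} [MeasurableSpace S] (μ' : Measure S) [IsFiniteMeasure μ'] (g : S → Y)
        (hg : Measurable g), Filter.Tendsto g (ae μ') (e.filter μ) →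
        klDiv (μ' ⊗ₘ ρ.comap g hg) (μ' ⊗ₘ σ.comap g hg) = ∫⁻ s, k (g s) ∂μ' := by
  obtain ⟨ν, p, q, hp, hq, H⟩ := h
  have hr : Measurable (Function.uncurry fun y t => p y t / q y t) := hp.div hq
  have hA : MeasurableSet {x : Y × T | Function.uncurry q x = 0} := hq (measurableSet_singleton 0)
  have H' : ∀ᶠ y in e.filter μ, IsLebesgueDecomp (ρ y) (σ y) (fun t => p y t / q y t)
      (Prod.mk y ⁻¹' {x : Y × T | Function.uncurry q x = 0}) :=
    H.mono fun y hy => isLebesgueDecomp_of_densities (hp.comp measurable_prodMk_left)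
      (hq.comp measurable_prodMk_left) hy.1 hy.2
  -- The witness is `klOf` for the quotient `p / q` and the zeros of `q`. It is measurable on all of
  -- `Y`, but it is known to be the divergence only at those observations where `p` and `q`
  -- represent the two channels.
  refine ⟨_, measurable_klOf ρ σ hr hA, H'.mono fun y hy => ?_, fun {S} _ μ' _ g hg ht => ?_⟩
  · exact (hy.klDiv_eq (hr.comp measurable_prodMk_left)).symm
  -- The decomposition is pulled back along `g × id`; the assumption on `g` says that `μ'`-almost
  -- every `g s` is an observation at which it is valid.
  · exact klDiv_compProd_eq_lintegral (κ := ρ.comap g hg) (η := σ.comap g hg)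
      (r := fun s t => p (g s) t / q (g s) t)
      (A := Prod.map g id ⁻¹' {x : Y × T | Function.uncurry q x = 0})
      (hr.comp (hg.prodMap measurable_id)) ((hg.prodMap measurable_id) hA) (ht.eventually H')

/-- Measurable functions agree at the observations considered by `e` if their integrals agree for all
finite measures concentrated there. -/
theorem LossEq.eventually_eq_of_lintegral_eq (e : LossEq) {Y : MeasCat.{u}}
    (μ : ProbabilityMeasure Y) {F G : Y → ℝ≥0∞} (hF : Measurable F) (hG : Measurable G)
    (h : ∀ (μ' : Measure Y) [IsFiniteMeasure μ'], ae μ' ≤ e.filter μ →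
      ∫⁻ y, F y ∂μ' = ∫⁻ y, G y ∂μ') : ∀ᶠ y in e.filter μ, F y = G y := by
  cases e with
  | pointwise =>
    -- Here every finite measure is an admissible test, in particular the Dirac mass at `y`.
    refine .of_forall fun y => ?_
    simpa [lintegral_dirac' y hF, lintegral_dirac' y hG] using h (Measure.dirac y) le_top
  | almostSure =>
    -- The admissible tests include the restrictions of `μ` to measurable sets.
    exact ae_eq_of_forall_setLIntegral_eq_of_sigmaFinite hF hG fun s _ _ =>
      h ((μ : Measure Y).restrict s) Measure.restrict_le_self.absolutelyContinuous.ae_le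

/-- For each fixed measurable `V` the masses `κ s V` and `η s V` agree for `μ`-almost all `s`, hence
for `μ'`-almost all `s`. The exceptional set may depend on `V`, but rectangles determine the
composition-product and involve one `V` at a time. -/
theorem compProd_eq_of_ae_le {S T : Type*} [MeasurableSpace S] [MeasurableSpace T]
    {μ μ' : Measure S} [IsFiniteMeasure μ] [IsFiniteMeasure μ'] {κ η : Kernel S T}
    [IsMarkovKernel κ] [IsMarkovKernel η] (h : μ ⊗ₘ κ = μ ⊗ₘ η) (hμ : ae μ' ≤ ae μ) :
    μ' ⊗ₘ κ = μ' ⊗ₘ η := by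
  refine Measure.ext_prod fun {U V} hU hV => ?_
  have key : (fun s => κ s V) =ᵐ[μ] fun s => η s V := by
    refine ae_eq_of_forall_setLIntegral_eq_of_sigmaFinite (Kernel.measurable_coe _ hV)
      (Kernel.measurable_coe _ hV) fun W hW _ => ?_
    rw [← Measure.compProd_apply_prod hW hV, h, Measure.compProd_apply_prod hW hV]
  rw [Measure.compProd_apply_prod hU hV, Measure.compProd_apply_prod hU hV]
  exact lintegral_congr_ae (ae_restrict_of_ae (hμ key))

/-! ### The chain rule for copy-composites. -/

/-- Reordering of the data produced by a copy-composite of backward channels. -/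
def bseqEquiv (A B C M N : Type*) [MeasurableSpace A] [MeasurableSpace B] [MeasurableSpace C]
    [MeasurableSpace M] [MeasurableSpace N] :
    (C × N × B) × M × A ≃ᵐ C × ((M × B) × N) × A where
  toFun t := (t.1.1, ((t.2.1, t.1.2.2), t.1.2.1), t.2.2)
  invFun t := ((t.1, t.2.1.2, t.2.1.1.2), t.2.1.1.1, t.2.2)
  left_inv _ := rfl
  right_inv _ := rfl
  measurable_toFun := by
    change Measurable fun t : (C × N × B) × M × A =>
      (t.1.1, ((t.2.1, t.1.2.2), t.1.2.1), t.2.2)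
    fun_prop
  measurable_invFun := by
    change Measurable fun t : C × ((M × B) × N) × A =>
      ((t.1, t.2.1.2, t.2.1.1.2), t.2.1.1.1, t.2.2)
    fun_prop

section Chain

variable {A B C M N : Type u} [MeasurableSpace A] [MeasurableSpace B] [MeasurableSpace C]
  [MeasurableSpace M] [MeasurableSpace N]

/-- Copy-composition forgets nothing: the middle value is kept in the coparameter. Hence the joint
law is an iterated composition-product up to a bijective relabelling. Were the middle value
discarded, data processing would give only an inequality below. -/
theorem compProd_bseq (μ : Measure C) [IsFiniteMeasure μ] (ρ : Kernel B (M × A))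
    [IsMarkovKernel ρ] (σ : Kernel C (N × B)) [IsMarkovKernel σ] :
    μ ⊗ₘ bseq ρ σ = ((μ ⊗ₘ σ) ⊗ₘ ρ.comap (fun t : C × N × B => t.2.2) (by fun_prop)).map
      (bseqEquiv A B C M N) := by
  refine Measure.ext_of_lintegral _ fun F hF => ?_
  have hF' : Measurable fun t => F (bseqEquiv A B C M N t) :=
    hF.comp (bseqEquiv A B C M N).measurable
  rw [lintegral_map hF (bseqEquiv A B C M N).measurable, Measure.lintegral_compProd hF,
    Measure.lintegral_compProd hF', Measure.lintegral_compProd hF'.lintegral_kernel_prod_right']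
  refine lintegral_congr fun c => ?_
  rw [lintegral_bseq _ _ _ (by fun_prop)]
  rfl

/-- The chain rule of relative entropy for copy-composites of backward channels. -/
theorem klDiv_compProd_bseq (μ : Measure C) [IsFiniteMeasure μ] (ρ ρ' : Kernel B (M × A))
    [IsMarkovKernel ρ] [IsMarkovKernel ρ'] (σ σ' : Kernel C (N × B)) [IsMarkovKernel σ]
    [IsMarkovKernel σ'] :
    klDiv (μ ⊗ₘ bseq ρ σ) (μ ⊗ₘ bseq ρ' σ') = klDiv (μ ⊗ₘ σ) (μ ⊗ₘ σ') +
      klDiv ((μ ⊗ₘ σ) ⊗ₘ ρ.comap (fun t : C × N × B => t.2.2) (by fun_prop))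
        ((μ ⊗ₘ σ) ⊗ₘ ρ'.comap (fun t : C × N × B => t.2.2) (by fun_prop)) := by
  -- Relabelling does not change the divergence, so the chain rule for composition-products applies.
  -- It averages the second stage over the law of the first argument, which is why `σ` and not `σ'`
  -- appears there; for lenses this is the actual backward channel rather than the inversion.
  rw [compProd_bseq, compProd_bseq, klDiv_map_equiv, klDiv_compProd_eq_add]

end Chain

/-! ### Bayesian inversions -/

section Bayes

variable {X Y Z : MeasCat.{u}}

/-- In terms of test functions an inversion is a rule for exchanging the order of two integrals, and
composing inversions becomes a matter of iterating such exchanges. -/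
theorem isBayesInversion_iff {c : Chan X Y} {π : ProbabilityMeasure X} {ρ : Kernel Y (c.M × X)}
    [IsMarkovKernel ρ] : IsBayesInversion c π ρ ↔ ∀ F : X × c.M × Y → ℝ≥0∞, Measurable F →
      ∫⁻ x, ∫⁻ w, F (x, w) ∂(c.ker x) ∂(π : Measure X) =
        ∫⁻ y, ∫⁻ w, F (w.2, w.1, y) ∂(ρ y) ∂(c.pred π : Measure Y) := by
  have hl : ∀ F : X × c.M × Y → ℝ≥0∞, Measurable F → ∫⁻ t, F t ∂((π : Measure X) ⊗ₘ c.ker) =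
      ∫⁻ x, ∫⁻ w, F (x, w) ∂(c.ker x) ∂(π : Measure X) := fun F hF =>
    Measure.lintegral_compProd hF
  have hr : ∀ F : X × c.M × Y → ℝ≥0∞, Measurable F →
      ∫⁻ t, F t ∂(((c.pred π : Measure Y) ⊗ₘ ρ).map (fun t => (t.2.2, t.2.1, t.1))) =
        ∫⁻ y, ∫⁻ w, F (w.2, w.1, y) ∂(ρ y) ∂(c.pred π : Measure Y) := fun F hF => by
    rw [lintegral_map hF (by fun_prop), Measure.lintegral_compProd (by fun_prop)]
  constructor
  · intro h F hF
    rw [← hl F hF, ← hr F hF, ← h]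
  · intro h
    exact Measure.ext_of_lintegral _ fun F hF => by rw [hl F hF, hr F hF, h F hF]

/-- Almost sure uniqueness: the joint law of an inversion with the predictive law is, up to order,
the law already determined by `π` and `c`. -/
theorem IsBayesInversion.compProd_eq {c : Chan X Y} {π : ProbabilityMeasure X}
    {ρ ρ' : Kernel Y (c.M × X)} [IsMarkovKernel ρ] [IsMarkovKernel ρ']
    (h : IsBayesInversion c π ρ) (h' : IsBayesInversion c π ρ') :
    (c.pred π : Measure Y) ⊗ₘ ρ = (c.pred π : Measure Y) ⊗ₘ ρ' := by
  refine Measure.ext_of_lintegral _ fun F hF => ?_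
  have hF' : Measurable fun t : X × c.M × Y => F (t.2.2, t.2.1, t.1) := by fun_prop
  rw [Measure.lintegral_compProd hF, Measure.lintegral_compProd hF]
  exact (isBayesInversion_iff.1 h _ hF').symm.trans (isBayesInversion_iff.1 h' _ hF')

theorem isBayesInversion_id (π : ProbabilityMeasure X) :
    IsBayesInversion (Chan.id X) π (idKer X) := by
  have hm : IsMarkovKernel (idKer X) := inferInstance
  refine (@isBayesInversion_iff _ _ (Chan.id X) π (idKer X) hm).2 fun F hF => ?_
  rw [Chan.pred_id]
  refine lintegral_congr fun x => ?_
  exact (lintegral_idKer x (hF.comp measurable_prodMk_left)).trans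
    (lintegral_idKer x (F := fun w => F (w.2, w.1, x)) (hF.comp (by fun_prop))).symm

/-- The joint law of `x`, `y`, `z` and the coparameters is disintegrated over `y` by the first
inversion and then over `z` by the second. Between the two, what lies before and what lies after `y`
are conditionally independent given `y`. -/
theorem IsBayesInversion.comp {c : Chan X Y} {d : Chan Y Z} {π : ProbabilityMeasure X}
    {ρ : Kernel Y (c.M × X)} [IsMarkovKernel ρ] {σ : Kernel Z (d.M × Y)} [IsMarkovKernel σ]
    (hρ : IsBayesInversion c π ρ) (hσ : IsBayesInversion d (c.pred π) σ) :
    IsBayesInversion (c.comp d) π (bseq ρ σ) := by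
  have hm : IsMarkovKernel (bseq ρ σ) := inferInstance
  refine (@isBayesInversion_iff _ _ (c.comp d) π (bseq ρ σ) hm).2 fun F hF => ?_
  change X × (((c.M × Y) × d.M) × Z) → ℝ≥0∞ at F
  change Measurable F at hF
  rw [Chan.pred_comp]
  calc ∫⁻ x, ∫⁻ t, F (x, t) ∂(seq c.ker d.ker x) ∂(π : Measure X)
      = ∫⁻ x, ∫⁻ w, ∫⁻ z, F (x, (w, z.1), z.2) ∂(d.ker w.2) ∂(c.ker x) ∂(π : Measure X) :=
        lintegral_congr fun x => lintegral_seq _ _ _ (by fun_prop)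
    _ = ∫⁻ y, ∫⁻ w, ∫⁻ z, F (w.2, ((w.1, y), z.1), z.2) ∂(d.ker y) ∂(ρ y)
          ∂(c.pred π : Measure Y) :=
        -- The draw from `d` depends only on `y`, so it is absorbed in the test function.
        isBayesInversion_iff.1 hρ
          (fun t => ∫⁻ z, F (t.1, (t.2, z.1), z.2) ∂(d.ker t.2.2)) (by fun_prop)
    _ = ∫⁻ y, ∫⁻ z, ∫⁻ w, F (w.2, ((w.1, y), z.1), z.2) ∂(ρ y) ∂(d.ker y)
          ∂(c.pred π : Measure Y) :=
        -- Tonelli: given `y`, the draws from `ρ` and from `d` are independent.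
        lintegral_congr fun y => lintegral_lintegral_swap (by fun_prop)
    _ = ∫⁻ z, ∫⁻ v, ∫⁻ w, F (w.2, ((w.1, v.2), v.1), z) ∂(ρ v.2) ∂(σ z)
          ∂(d.pred (c.pred π) : Measure Z) :=
        isBayesInversion_iff.1 hσ
          (fun t => ∫⁻ w, F (w.2, ((w.1, t.1), t.2.1), t.2.2) ∂(ρ t.1)) (by fun_prop)
    _ = ∫⁻ z, ∫⁻ t, F (t.2, t.1, z) ∂(bseq ρ σ z) ∂(d.pred (c.pred π) : Measure Z) :=
        lintegral_congr fun z => (lintegral_bseq _ _ _ (F := fun t => F (t.2, t.1, z))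
          (by fun_prop)).symm

end Bayes

/-! ### Strict loss models from compatible losses -/

namespace SGame

open Bicategory

/-- Apart from proofs, the only further data are the comparison isomorphisms for identities and
composites, and strictness forces these to be the ones coming from equalities. -/
theorem strictPseudofunctor_ext {C : Type*} [Bicategory C] {D : Type*} [Bicategory D]
    {F G : StrictPseudofunctor C D}
    (h : F.toPrelaxFunctorStruct = G.toPrelaxFunctorStruct) : F = G := by
  obtain ⟨⟨⟨⟨F, _, _⟩, _, _, _, _, _, _, _⟩, _, hF⟩, _, hF'⟩ := F
  obtain ⟨⟨⟨⟨G, _, _⟩, _, _, _, _, _, _, _⟩, _, hG⟩, _, hG'⟩ := G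
  dsimp only at h
  subst h
  congr
  · exact funext fun X => (hF X).trans (hG X).symm
  · funext a b c f g
    exact (hF' f g).trans (hG' f g).symm

variable {B : SubBicat BLens.{u}} {e : LossEq} {hB : Nonsingular B e}

/-- Meant for games with the same lens whose losses are equal but not by definition, so that
`eqToHom` intervenes in the coherence conditions. With zero losses, only the underlying 2-cells of
lenses have to be compared. -/
theorem eq_eqToHom_comp {X Y : SGame B e hB} {f g f' : X ⟶ Y} {η : f ⟶ g} {θ : f' ⟶ g}
    (h : f = f') (hc : HEq η.cell θ.cell) (hη : η.loss = 0) (hθ : θ.loss = 0) :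
    η = eqToHom h ≫ θ := by
  subst h
  rw [eqToHom_refl, Category.id_comp]
  exact hom₂_ext (eq_of_heq hc) (hη.trans hθ.symm)

theorem eq_eqToHom_comp_comp {X Y : SGame B e hB} {f g f' g' : X ⟶ Y} {η : f ⟶ g}
    {θ : f' ⟶ g'} (h : f = f') (h' : g' = g) (hc : HEq η.cell θ.cell) (hη : η.loss = 0)
    (hθ : θ.loss = 0) : η = eqToHom h ≫ θ ≫ eqToHom h' := by
  subst h'
  rw [eqToHom_refl, Category.comp_id]
  exact eq_eqToHom_comp h hc hη hθ

/-- A lens with the loss assigned to it. -/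
def gameOf (hB : Nonsingular B e) (L : ∀ {X Y : B.Obj} (f : X ⟶ Y), LossOf e f) {X Y : B.Obj}
    (f : X ⟶ Y) : (⟨X⟩ : SGame B e hB) ⟶ ⟨Y⟩ :=
  Game.mk (X := (⟨X⟩ : SGame B e hB)) (Y := ⟨Y⟩) f (L f)

section Model

variable {L : ∀ {X Y : B.Obj} (f : X ⟶ Y), LossOf e f}
  (hid : ∀ X : B.Obj, L (𝟙 X) = 0)
  (hcomp : ∀ {X Y Z : B.Obj} (f : X ⟶ Y) (g : Y ⟶ Z),
    L (f ≫ g) = reindex f g (L g) + pull hB f g (L f))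

include hid in
theorem gameOf_id (X : B.Obj) : gameOf hB L (𝟙 X) = 𝟙 (⟨X⟩ : SGame B e hB) :=
  congrArg (Game.mk (X := (⟨X⟩ : SGame B e hB)) (Y := ⟨X⟩) (𝟙 X)) (hid X)

include hcomp in
theorem gameOf_comp {X Y Z : B.Obj} (f : X ⟶ Y) (g : Y ⟶ Z) :
    gameOf hB L (f ≫ g) = gameOf hB L f ≫ gameOf hB L g :=
  congrArg (Game.mk (X := (⟨X⟩ : SGame B e hB)) (Y := ⟨Z⟩) (f ≫ g)) (hcomp f g)

/-- `castLoss` uses no more of a 2-cell than the resulting equality of predictive laws, so any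
2-cell in the opposite direction undoes it. This handles the inverse generators. -/
theorem castLoss_symm {X Y : B.Obj} {f g : X ⟶ Y} {η : f ⟶ g} (θ : g ⟶ f) {K : LossOf e f}
    {K' : LossOf e g} (h : K = castLoss η K') : K' = castLoss θ K := by
  rw [h, ← castLoss_comp, castLoss_self]

include hid hcomp in
/-- Losses which are additive along identities and composition are invariant under structural
2-cells. -/
theorem loss_eq_castLoss {X Y : B.Obj} {f g : X ⟶ Y} (η : f ⟶ g) : L f = castLoss η (L g) := by
  obtain ⟨v, s⟩ := η
  -- For the associator and the unitors, additivity turns both sides into losses of composite games,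
  -- which are already known to agree.
  have ha : ∀ {W X Y Z : B.Obj} (f : W ⟶ X) (g : X ⟶ Y) (h : Y ⟶ Z),
      L ((f ≫ g) ≫ h) = castLoss (α_ f g h).hom (L (f ≫ g ≫ h)) := by
    intro W X Y Z f g h
    rw [hcomp (f ≫ g) h, hcomp f g, hcomp f (g ≫ h), hcomp g h]
    exact assoc_loss (gameOf hB L f) (gameOf hB L g) (gameOf hB L h)
  have hl : ∀ {X Y : B.Obj} (f : X ⟶ Y), L (𝟙 X ≫ f) = castLoss (λ_ f).hom (L f) := by
    intro X Y f
    rw [hcomp, hid]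
    exact leftUnitor_loss (gameOf hB L f)
  have hr : ∀ {X Y : B.Obj} (f : X ⟶ Y), L (f ≫ 𝟙 Y) = castLoss (ρ_ f).hom (L f) := by
    intro X Y f
    rw [hcomp, hid]
    exact rightUnitor_loss (gameOf hB L f)
  induction s with
  | id f => exact (castLoss_self (𝟙 f) (L f)).symm
  | comp s t ihs iht =>
    rw [ihs, iht]
    exact (castLoss_comp (SubBicat.Hom₂.mk _ s) (SubBicat.Hom₂.mk _ t) _).symm
  | whiskerLeft f s ih =>
    -- By induction `s` with `K = 0` is a 2-cell of games. The equation carried by its whiskering is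
    -- the claim, up to the image of `0` under an additive map.
    have := (SGame.whiskerLeft (gameOf hB L f) (g := gameOf hB L _) (h := gameOf hB L _)
      (Hom₂.mk ⟨_, s⟩ 0 (ih.trans (add_zero _).symm))).eq
    rw [hcomp, hcomp]
    refine this.trans ?_
    exact (congrArg _ (map_zero _)).trans (add_zero _)
  | whiskerRight h s ih =>
    have := (SGame.whiskerRight (f := gameOf hB L _) (g := gameOf hB L _)
      (Hom₂.mk ⟨_, s⟩ 0 (ih.trans (add_zero _).symm)) (gameOf hB L h)).eq
    rw [hcomp, hcomp]
    refine this.trans ?_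
    exact (congrArg _ (map_zero _)).trans (add_zero _)
  | associator f g h => exact ha f g h
  | associatorInv f g h => exact castLoss_symm _ (ha f g h)
  | leftUnitor f => exact hl f
  | leftUnitorInv f => exact castLoss_symm _ (hl f)
  | rightUnitor f => exact hr f
  | rightUnitorInv f => exact castLoss_symm _ (hr f)

/-- Losses which are additive along identities and composition form a strict loss model. -/
noncomputable def lossModel : StrictPseudofunctor B.Obj (SGame B e hB) :=
  StrictPseudofunctor.mk'
    { obj X := ⟨X⟩
      map f := gameOf hB L f
      -- Invariance under structural 2-cells allows the difference of losses to be `0` throughout;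
      -- all coherence conditions then reduce to those of the underlying lenses.
      map₂ η := Hom₂.mk η 0
        ((loss_eq_castLoss hid hcomp η).trans (add_zero _).symm)
      map₂_id _ := rfl
      map₂_comp η _ := hom₂_ext rfl
        ((congrArg (· + 0) (map_zero (castLoss η))).trans (add_zero _)).symm
      map_id X := gameOf_id hid X
      map_comp f g := gameOf_comp hcomp f g
      map₂_whisker_left _ _ _ _ := eq_eqToHom_comp_comp _ _ HEq.rfl rfl (map_zero _)
      map₂_whisker_right _ _ := eq_eqToHom_comp_comp _ _ HEq.rfl rfl (map_zero _)
      map₂_left_unitor _ := eq_eqToHom_comp _ HEq.rfl rfl rfl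
      map₂_right_unitor _ := eq_eqToHom_comp _ HEq.rfl rfl rfl
      map₂_associator _ _ _ := eq_eqToHom_comp_comp _ _ HEq.rfl rfl rfl }

include hid hcomp in
theorem isStrictLossModel : IsStrictLossModel hB L :=
  ⟨lossModel hid hcomp, rfl, strictPseudofunctor_ext rfl⟩

end Model

end SGame

/-! ### Relative entropy of lenses -/

section Entropy

variable {e : LossEq} {B : SubBicat BLens.{u}} {dag : Inversion.{u}}

/-- Nonsingularity of backward channels, for measures on observations. -/
theorem Nonsingular.tendsto (hB : Nonsingular B e) {X Y : B.Obj} (f : X ⟶ Y)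
    (π : ProbabilityMeasure X.val.space) (μ' : Measure Y.val.space) [IsFiniteMeasure μ']
    (hμ' : ae μ' ≤ e.filter (f.val.fwd.pred π)) :
    Filter.Tendsto (fun t : Y.val.space × f.val.fwd.M × X.val.space => t.2.2)
      (ae (μ' ⊗ₘ f.val.bwd π)) (e.filter π) := by
  cases e with
  -- The filter is `⊤`: there are no exceptional points to avoid.
  | pointwise => exact Filter.tendsto_top
  | almostSure =>
    refine Measure.tendsto_ae_map (f := fun t : Y.val.space × f.val.fwd.M × X.val.space => t.2.2)
      (by fun_prop) |>.mono_right ?_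
    -- What is needed is that the `X`-marginal of `μ' ⊗ₘ f.val.bwd π` is absolutely continuous with
    -- respect to `π`.
    refine (Measure.AbsolutelyContinuous.mk fun S hS h0 => ?_).ae_le
    -- Nonsingularity for the conull set `Sᶜ` holds at almost every predicted observation, hence
    -- `μ'`-almost everywhere.
    have h1 := hμ' (hB f π Sᶜ (compl_mem_ae_iff.2 h0))
    rw [Measure.map_apply (by fun_prop) hS, ← compl_mem_ae_iff]
    refine Measure.ae_compProd_of_ae_ae 
      (p := fun t : Y.val.space × f.val.fwd.M × X.val.space => t.2.2 ∈ Sᶜ)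
      ((by fun_prop : Measurable fun t : Y.val.space × f.val.fwd.M × X.val.space => t.2.2)
        hS.compl) ?_
    filter_upwards [h1] with y hy
    rw [Kernel.snd_apply] at hy
    exact ae_of_ae_map (by fun_prop) hy

/-- Chosen inversions of identities agree with the identity channels, at the observations considered
by `e`. -/
theorem Inversion.compProd_id (hdag : dag.IsExactOn B)
    (hstrict : e = .pointwise → dag.IsStrictOn B) (X : B.Obj)
    (π : ProbabilityMeasure X.val.space) (μ' : Measure X.val.space) [IsFiniteMeasure μ']
    (hμ' : ae μ' ≤ e.filter π) :
    μ' ⊗ₘ dag (Chan.id X.val.space) π = μ' ⊗ₘ idKer X.val.space := by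
  cases e with
  | pointwise => rw [(hstrict rfl).1]; rfl
  | almostSure =>
    have hm : IsMarkovKernel (dag (Chan.id X.val.space) π) := (hdag (𝟙 X) π).1
    have hm' : IsMarkovKernel (idKer X.val.space) := inferInstance
    -- The identity channel is its own inversion, so uniqueness identifies it with the chosen one
    -- under the predictive law, here `π` itself, and then under `μ'`.
    have h := @IsBayesInversion.compProd_eq _ _ (Chan.id X.val.space) π _
      (idKer X.val.space) hm hm' (hdag (𝟙 X) π).2 (isBayesInversion_id π)
    rw [Chan.pred_id] at h
    exact @compProd_eq_of_ae_le _ _ _ _ _ _ _ _ _ _ hm hm' h hμ'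

/-- Chosen inversions are compatible with copy-composition, at the observations considered by `e`. -/
theorem Inversion.compProd_comp (hdag : dag.IsExactOn B)
    (hstrict : e = .pointwise → dag.IsStrictOn B) {X Y Z : B.Obj} (f : X ⟶ Y) (g : Y ⟶ Z)
    (π : ProbabilityMeasure X.val.space) (μ' : Measure Z.val.space) [IsFiniteMeasure μ']
    (hμ' : ae μ' ≤ e.filter (g.val.fwd.pred (f.val.fwd.pred π))) :
    μ' ⊗ₘ dag (f.val.fwd.comp g.val.fwd) π =
      μ' ⊗ₘ bseq (dag f.val.fwd π) (dag g.val.fwd (f.val.fwd.pred π)) := by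
  cases e with
  | pointwise => rw [(hstrict rfl).2]; rfl
  | almostSure =>
    have hf := (hdag f π).1
    have hg := (hdag g (f.val.fwd.pred π)).1
    have hm : IsMarkovKernel (dag (f.val.fwd.comp g.val.fwd) π) := (hdag (f ≫ g) π).1
    have hm' : IsMarkovKernel (bseq (dag f.val.fwd π) (dag g.val.fwd (f.val.fwd.pred π))) :=
      inferInstance
    -- The copy-composite of the chosen inversions is another inversion of the same channel, so it
    -- agrees almost surely with the chosen one.
    have h := @IsBayesInversion.compProd_eq _ _ (f.val.fwd.comp g.val.fwd) π _
      (bseq (dag f.val.fwd π) (dag g.val.fwd (f.val.fwd.pred π))) hm hm' (hdag (f ≫ g) π).2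
      ((hdag f π).2.comp (hdag g (f.val.fwd.pred π)).2)
    rw [Chan.pred_comp] at h
    exact @compProd_eq_of_ae_le _ _ _ _ _ _ _ _ _ _ hm hm' h hμ'

end Entropy

end StatGames

/-! ### Relative entropy is a strict loss model. -/

open StatGames
theorem mainTheorem1 (e : LossEq) (B : SubBicat BLens.{u}) (hB : Nonsingular B e)
    (dag : Inversion.{u}) (hdag : dag.IsExactOn B)
    (hstrict : e = .pointwise → dag.IsStrictOn B)
    (hdens : ∀ {X Y : B.Obj} (f : X ⟶ Y) (π : ProbabilityMeasure X.val.space),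
      HasDensities (T := .of (f.val.fwd.M × X.val.space)) e (f.val.fwd.pred π)
        (f.val.bwd π) (dag f.val.fwd π)) :
    ∃ KL : ∀ {X Y : B.Obj} (f : X ⟶ Y), SGame.LossOf e f,
      (∀ {X Y : B.Obj} (f : X ⟶ Y), ∃ ℓ : Loss X.val.space Y.val.space,
        KL f = LossClass.mk e f.val.fwd.pred ℓ ∧
        ∀ π, ∀ᶠ y in e.filter (f.val.fwd.pred π),
          ℓ.val π y = InformationTheory.klDiv (f.val.bwd π y) (dag f.val.fwd π y)) ∧
      SGame.IsStrictLossModel hB KL := by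
  have key : ∀ (X Y : B.Obj) (f : X ⟶ Y) (π : ProbabilityMeasure X.val.space),
      ∃ k : Y.val.space → ℝ≥0∞, Measurable k ∧
        (∀ᶠ y in e.filter (f.val.fwd.pred π),
          k y = InformationTheory.klDiv (f.val.bwd π y) (dag f.val.fwd π y)) ∧
        ∀ {S : Type u} [MeasurableSpace S] (μ' : Measure S) [IsFiniteMeasure μ']
          (g : S → Y.val.space) (hg : Measurable g),
          Filter.Tendsto g (ae μ') (e.filter (f.val.fwd.pred π)) →
          InformationTheory.klDiv (μ' ⊗ₘ (f.val.bwd π).comap g hg)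
            (μ' ⊗ₘ (dag f.val.fwd π).comap g hg) = ∫⁻ s, k (g s) ∂μ' := fun X Y f π =>
    @HasDensities.exists_klDiv e _ (.of (f.val.fwd.M × X.val.space)) _ _ _ (f.val.markov π)
      (hdag f π).1 (hdens f π)
  choose k hk hk_eq hk_int using key
  -- The integral formula with `g = id`. The general form is needed only for the second stage of a
  -- composite, where the observation is one coordinate of a larger sample.
  have hk_int' : ∀ (X Y : B.Obj) (f : X ⟶ Y) (π : ProbabilityMeasure X.val.space)
      (μ' : Measure Y.val.space) [IsFiniteMeasure μ'], ae μ' ≤ e.filter (f.val.fwd.pred π) →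
      InformationTheory.klDiv (μ' ⊗ₘ f.val.bwd π) (μ' ⊗ₘ dag f.val.fwd π) =
        ∫⁻ y, k X Y f π y ∂μ' := fun X Y f π μ' _ h =>
    hk_int X Y f π μ' id measurable_id (Filter.tendsto_id'.2 h)
  refine ⟨fun {X Y} f => LossClass.mk e f.val.fwd.pred ⟨k X Y f, hk X Y f⟩,
    fun {X Y} f => ⟨_, rfl, hk_eq X Y f⟩, SGame.isStrictLossModel ?_ ?_⟩
  · intro X
    refine Quotient.sound fun π => ?_
    refine e.eventually_eq_of_lintegral_eq _ (hk X X (𝟙 X) π) measurable_const ?_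
    intro μ' _ hμ'
    -- The integrated loss is the divergence between two joint laws that coincide.
    rw [← hk_int' X X (𝟙 X) π μ' hμ', lintegral_zero]
    rw [SGame.pred_id] at hμ'
    have h := Inversion.compProd_id hdag hstrict X π μ' hμ'
    have hm : IsFiniteMeasure (μ' ⊗ₘ idKer X.val.space) := inferInstance
    refine (congrArg _ h).trans ?_
    exact InformationTheory.klDiv_self (μ' ⊗ₘ idKer X.val.space)
  · intro X Y Z f g
    refine Quotient.sound fun π => ?_
    have hmeas : Measurable fun z => ∫⁻ y, k X Y f π y ∂((g.val.bwd (f.val.fwd.pred π)).snd z) :=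
      (hk X Y f π).lintegral_kernel
    refine e.eventually_eq_of_lintegral_eq _ (hk X Z (f ≫ g) π)
      ((hk Y Z g (f.val.fwd.pred π)).add hmeas) ?_
    intro μ' _ hμ'
    have hf := (hdag f π).1
    have hg := (hdag g (f.val.fwd.pred π)).1
    -- The loss of a composite game discards the coparameter of the backward channel of `g`, while
    -- the chain rule keeps it. As the integrand depends on `y` alone, the integrals agree.
    have hsnd : ∀ z, ∫⁻ y, k X Y f π y ∂((g.val.bwd (f.val.fwd.pred π)).snd z) =
        ∫⁻ t, k X Y f π t.2 ∂(g.val.bwd (f.val.fwd.pred π) z) := fun z =>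
      Kernel.lintegral_snd _ _ (hk X Y f π)
    rw [← hk_int' X Z (f ≫ g) π μ' hμ', lintegral_add_right _ hmeas]
    rw [SGame.pred_comp] at hμ'
    have hprod := Measure.lintegral_compProd (μ := μ') (κ := g.val.bwd (f.val.fwd.pred π))
      (f := fun t : Z.val.space × g.val.fwd.M × Y.val.space => k X Y f π t.2.2)
      ((hk X Y f π).comp (by fun_prop))
    -- Each summand is read as a divergence of joint laws. The second is taken over the sample `(z,
    -- n, y)`, whose `y` avoids the exceptional observations of `f` because the backward channel of
    -- `g` is nonsingular. Read backwards, the chain rule merges the two.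
    rw [← hk_int' Y Z g _ μ' hμ', lintegral_congr hsnd, ← hprod, ← hk_int X Y f π _ _ (by fun_prop) (hB.tendsto g (f.val.fwd.pred π) μ' hμ'),
      ← klDiv_compProd_bseq]
    -- The backward channel of `f ≫ g` is a copy-composite by definition; its chosen inversion is
    -- one only under `μ'`, which suffices.
    exact congrArg _ (Inversion.compProd_comp hdag hstrict f g π μ' hμ')
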